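/- **Setting.** All spaces $\mathbb{R}^S$ ($S$ a finite set, possibly a product of sets) carry the Euclidean norm $\|\cdot\|$ (the Frobenius norm for matrices), and $v^{\otimes 2}[s,t] := v[s]v[t]$. For $p\ge 1$ the Wasserstein distance of order $p$ between two laws is $\mathcal{W}_p(\mu,\nu) = \inf \mathbb{E}[\|X-Y\|^p]^{1/p}$, the infimum running over all jointly defined random variables $X, Y$ with laws $\mu$ and $\nu$; between random variables it is the distance between their laws. For a Lipschitz function $h$ with Lipschitz constant $\operatorname{Lip}(h)$ let $\|h\|_{\operatorname{Lip}} := \|h(0)\| + \operatorname{Lip}(h)$. Fix a number $L$ of layers, finite sets $S_0, \dots, S_L$, integers $a_1, \dots, a_L\ge 0$, activation functions $\sigma^{(\ell)}:\mathbb{R}^{S_{\ell-1}}\to\mathbb{R}^{a_\ell\times S_\ell}$ ($\ell=1,\dots,L$), and an input $x\in\mathbb{R}^{S_0}$ (for a set $\mathcal{X}$ of $k$ inputs in $\mathbb{R}^{d_0}$, $S_0 = d_0\times k$ and $x$ is the matrix of the inputs). *Network.* For layer widths $n_0:=1$ and $n_1,\dots,n_L\ge 1$, let the weights $W^{(\ell)}\in\mathbb{R}^{n_\ell\times(n_{\ell-1}\times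 a_\ell)}$, $\ell = 1,\dots,L$, have entries that are all independent (within and across layers), those of $W^{(\ell)}$ being centered Gaussian with variance $1/n_{\ell-1}$. Define $f^{(\ell)}$ with values in $\mathbb{R}^{n_\ell\times S_\ell}$ by $f^{(0)} := x$ and, for $\ell=1,\dots,L$, $$f^{(\ell)}[i,s] := \sum_{j=1}^{n_{\ell-1}}\sum_{\alpha=1}^{a_\ell} W^{(\ell)}[i,(j,\alpha)]\;\sigma^{(\ell)}\big(f^{(\ell-1)}[j,:]\big)[\alpha,s].$$ *Gaussian limit.* Let $G^{(0)}:=x$ be constant and, for $\ell=1,\dots,L$, let $G^{(\ell)}$ be a centered Gaussian variable with values in $\mathbb{R}^{S_\ell}$ and covariance $$K^{(\ell)}[s,t] := \sum_{\alpha=1}^{a_\ell}\mathbb{E}\big[\sigma^{(\ell)}(G^{(\ell-1)})[\alpha,s]\;\sigma^{(\ell)}(G^{(\ell-1)})[\alpha,t]\big].$$ Let $G^{(\ell)}_{n_\ell}$, with values in $\mathbb{R}^{n_\ell\times S_\ell}$, be the collection of $n_\ell$ independent copies of $G^{(\ell)}$. **Theorem.** Assume that $\sigma^{(1)},\dots,\sigma^{(L)}$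 are Lipschitz continuous (the $K^{(\ell)}$ may be degenerate). Then for every real $p\ge 1$ there is a constant $0<\mathsf{c}<\infty$, depending only on $p$, $L$, the input $x$, $(S_\ell)$, $(a_\ell)$ and $(\sigma^{(\ell)})$, and not on the widths $n_1,\dots,n_L$, such that for every $\ell\in\{0,1,\dots,L\}$ $$\mathcal{W}_p\big(f^{(\ell)}, G^{(\ell)}_{n_\ell}\big)\le \mathsf{c}\,\sqrt{n_\ell}\,\sum_{i=1}^{\ell-1}\frac{1}{\sqrt{n_i}},$$ and for every finite set $T$ and every Lipschitz continuous $h:\mathbb{R}^{S_\ell}\to\mathbb{R}^T$ $$\mathcal{W}_p\Big(\frac{1}{n_\ell}\sum_{i=1}^{n_\ell} h\big(f^{(\ell)}[i,:]\big)^{\otimes 2},\; \mathbb{E}\big[h(G^{(\ell)})^{\otimes 2}\big]\Big)\le \mathsf{c}\,\|h\|_{\operatorname{Lip}}^2\sum_{i=1}^{\ell}\frac{1}{\sqrt{n_i}}.$$ Empty sums are $0$. -/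

import Mathlib

open MeasureTheory ProbabilityTheory
open scoped NNReal ENNReal

noncomputable section

universe u

/-- The Wasserstein distance of order `p` between two measures on a normed space: the infimum, over
all couplings `π` of `μ` and `ν`, of the `L^p` norm of `X - Y`, where `(X, Y)` has law `π`.
It takes values in `[0, ∞]`, and on `EuclideanSpace ℝ ι` the norm is the Euclidean one. -/
def wasserstein {E : Type*} [NormedAddCommGroup E] [MeasurableSpace E]
    (p : ℝ) (μ ν : Measure E) : ℝ≥0∞ :=
  ⨅ (π : Measure (E × E)) (_ : π.fst = μ) (_ : π.snd = ν),
    eLpNorm (fun z : E × E => z.1 - z.2) (ENNReal.ofReal p) π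

/-- The tensor square `v ⊗ v`, a vector indexed by `T × T`; its Euclidean norm is the Frobenius
norm of the matrix `(v[s] v[t])_{s,t}`. -/
def tensorSq {T : Type*} (v : EuclideanSpace ℝ T) : EuclideanSpace ℝ (T × T) :=
  WithLp.toLp 2 fun q => v q.1 * v q.2

/-- The row `A[i, :]` of an array `A` indexed by `{1, …, n} × S`. -/
def row {n : ℕ} {S : Type*} (A : EuclideanSpace ℝ (Fin n × S)) (i : Fin n) :
    EuclideanSpace ℝ S :=
  WithLp.toLp 2 fun s => A (i, s)

/-- `(1/n) ∑ᵢ h(A[i, :]) ⊗ h(A[i, :])`. -/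
def empiricalKernel {n : ℕ} {S T : Type*} (h : EuclideanSpace ℝ S → EuclideanSpace ℝ T)
    (A : EuclideanSpace ℝ (Fin n × S)) : EuclideanSpace ℝ (T × T) :=
  (n : ℝ)⁻¹ • ∑ i, tensorSq (h (row A i))

section Network

variable {S : ℕ → Type u} {a : ℕ → ℕ}
  (σ : ∀ ℓ, EuclideanSpace ℝ (S ℓ) → EuclideanSpace ℝ (Fin (a (ℓ + 1)) × S (ℓ + 1)))
  (x : EuclideanSpace ℝ (S 0))

/-- The network with auxiliary dimensions `S`, `a`, input `x`, layer widths `n` and weights `w`.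
The activation function and the weights used to pass from layer `ℓ` to layer `ℓ + 1` (those of
index `ℓ + 1` in the usual notation) are `σ ℓ` and `w ℓ`. The width `n 0` is meant to be `1`. -/
def network (n : ℕ → ℕ)
    (w : ∀ ℓ, Fin (n (ℓ + 1)) → Fin (n ℓ) → Fin (a (ℓ + 1)) → ℝ) :
    ∀ ℓ, EuclideanSpace ℝ (Fin (n ℓ) × S ℓ)
  | 0 => WithLp.toLp 2 fun q => x q.2
  | ℓ + 1 => WithLp.toLp 2 fun q =>
      ∑ j, ∑ α, w ℓ q.1 j α * σ ℓ (row (network n w ℓ) j) (α, q.2)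

/-- The partial trace over `{1, …, m}` of the second moment `E[g(Z) ⊗ g(Z)]`, where `Z` has
law `μ`. -/
def tracedSecondMoment {S₀ S₁ : Type*} {m : ℕ}
    (g : EuclideanSpace ℝ S₀ → EuclideanSpace ℝ (Fin m × S₁))
    (μ : Measure (EuclideanSpace ℝ S₀)) : Matrix S₁ S₁ ℝ :=
  Matrix.of fun s t => ∑ α : Fin m, ∫ z, g z (α, s) * g z (α, t) ∂μ

variable [∀ ℓ, Fintype (S ℓ)] [∀ ℓ, DecidableEq (S ℓ)]

/-- The law of the Gaussian variable `G^(ℓ)` with values in `ℝ^(S ℓ)`: at `ℓ = 0` it is the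
constant `x`; at `ℓ + 1` it is the centered Gaussian law whose covariance is the infinite-width
covariance `K^(ℓ+1)`, the traced second moment of the activation at `G^(ℓ)`. -/
def limitLaw : ∀ ℓ, Measure (EuclideanSpace ℝ (S ℓ))
  | 0 => Measure.dirac x
  | ℓ + 1 => multivariateGaussian 0 (tracedSecondMoment (σ ℓ) (limitLaw ℓ))

/-- The law of `n` independent copies of `G^(ℓ)`, arranged as the rows of an array. -/
def limitLawCopies (n ℓ : ℕ) : Measure (EuclideanSpace ℝ (Fin n × S ℓ)) :=
  (Measure.pi fun _ : Fin n => limitLaw σ x ℓ).map fun g => WithLp.toLp 2 fun q => g q.1 q.2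

end Network

/-- The entries of the random weights of the layers `1, …, L` are independent, and those of the
matrix from layer `ℓ` to layer `ℓ + 1` are centered Gaussian with variance `1 / n ℓ`. -/
structure IsGaussianWeights {Ω : Type*} [MeasurableSpace Ω] (P : Measure Ω) (L : ℕ)
    (n a : ℕ → ℕ) (W : ∀ ℓ, Fin (n (ℓ + 1)) → Fin (n ℓ) → Fin (a (ℓ + 1)) → Ω → ℝ) : Prop where
  hasLaw : ∀ ℓ < L, ∀ i j α, HasLaw (W ℓ i j α) (gaussianReal 0 (n ℓ : ℝ≥0)⁻¹) P
  indep : iIndepFun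
    (fun q : (Σ ℓ : Fin L, Fin (n (ℓ + 1)) × Fin (n ℓ) × Fin (a (ℓ + 1))) =>
      W q.1 q.2.1 q.2.2.1 q.2.2.2) P

end

/-! ### Couplings and Wasserstein distances -/

section Wasserstein

/-! Given layer `ℓ`, the rows of layer `ℓ + 1` are independent Gaussian vectors whose covariance is
the empirical second moment of the activations. Independence of the weights across layers turns the
network into the recursion of laws `networkLaw` (`IsGaussianWeights.map_network`). By monotonicity
in the order it suffices to treat even orders `2k`.

One step of the recursion is compared with the limit by inserting the layer fed with `n ℓ`
independent copies of `G^(ℓ)`.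

Replacing the true layer by the copies: with the same weights on both sides, Gaussian noise of
variance `1 / n ℓ` turns a distance `d` between inputs into at most a constant times `√(n (ℓ + 1) /
n ℓ) * d` (`LipschitzWith.exists_wasserstein_layerLaw_le`). The factor `√(n ℓ)` of the induction
hypothesis cancels, so errors simply add up along the layers.

Replacing the layer fed with copies by its Gaussian limit: the conditional covariance is an i.i.d.
average with mean `K`. Where `K` degenerates, the matrix square root is only Hölder continuous, so
comparing square roots directly could lose the rate. `LipschitzWith.exists_whitening` instead writes
`K = R Rᵀ` and the empirical covariance as `R M Rᵀ`, with `M` a positive semidefinite i.i.d. average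
of mean `1`. Driving both sides by the same Gaussian array, through `√M Rᵀ` and `Rᵀ`, costs at most
a multiple of `‖√M - 1‖ ≤ ‖M - 1‖` (`sum_sq_sqrt_sub_one_le`), with no lower bound on `K`. Moments
of i.i.d. sums make this of order `1 / √(n ℓ)`, and it vanishes at the deterministic input.

For the empirical kernel, a nearly optimal coupling with the copies is combined with Cauchy–Schwarz
(`LipschitzWith.eLpNorm_empiricalKernel_sub_le`); the kernel of the copies fluctuates by the same
i.i.d. estimate. That estimate is proved in arbitrary Hilbert spaces
(`exists_integral_norm_sum_pow_le`), so its constant does not see `T` or `h`. -/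

theorem wasserstein_mono_exponent {E : Type*} [NormedAddCommGroup E] [MeasurableSpace E]
    [BorelSpace E] [SecondCountableTopology E] {p q : ℝ} (hpq : p ≤ q) (μ ν : Measure E)
    [IsProbabilityMeasure μ] : wasserstein p μ ν ≤ wasserstein q μ ν := by
  refine le_iInf fun π => le_iInf fun h₁ => le_iInf fun h₂ => ?_
  refine (iInf_le_of_le π (iInf_le_of_le h₁ (iInf_le _ h₂))).trans ?_
  have : IsProbabilityMeasure π := by
    constructor
    have := measure_univ (μ := μ)
    rw [← h₁, Measure.fst_univ] at this
    exact this
  exact eLpNorm_le_eLpNorm_of_exponent_le (ENNReal.ofReal_le_ofReal hpq)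
    (measurable_fst.sub measurable_snd).aestronglyMeasurable

/-- The joint law of `(X, Y)` is a coupling. Every upper bound below comes from realising two laws
on one space in this way. -/
theorem wasserstein_map_le {Ω E : Type*} [MeasurableSpace Ω] [NormedAddCommGroup E]
    [MeasurableSpace E] [BorelSpace E] [SecondCountableTopology E] (p : ℝ) (ρ : Measure Ω)
    {X Y : Ω → E} (hX : AEMeasurable X ρ) (hY : AEMeasurable Y ρ) :
    wasserstein p (ρ.map X) (ρ.map Y) ≤
      eLpNorm (fun ω => X ω - Y ω) (ENNReal.ofReal p) ρ := by
  refine iInf_le_of_le (ρ.map fun ω => (X ω, Y ω)) (iInf_le_of_le ?_ (iInf_le_of_le ?_ ?_))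
  · exact Measure.fst_map_prodMk₀ hY
  · exact Measure.snd_map_prodMk₀ hX
  · rw [eLpNorm_map_measure (g := fun z : E × E => z.1 - z.2)
      (measurable_fst.sub measurable_snd).aestronglyMeasurable (hX.prodMk hY)]
    rfl

theorem wasserstein_self {E : Type*} [NormedAddCommGroup E]
    [MeasurableSpace E] [BorelSpace E] [SecondCountableTopology E] (p : ℝ) (μ : Measure E) :
    wasserstein p μ μ = 0 := by
  have := wasserstein_map_le p μ (aemeasurable_id (μ := μ)) (aemeasurable_id (μ := μ))
  simpa using this

theorem exists_coupling_lt {E : Type*} [NormedAddCommGroup E] [MeasurableSpace E] {p : ℝ}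
    {μ ν : Measure E} [IsProbabilityMeasure μ] {δ : ℝ≥0∞} (h : wasserstein p μ ν < δ) :
    ∃ π : Measure (E × E), IsProbabilityMeasure π ∧ π.fst = μ ∧ π.snd = ν ∧
      eLpNorm (fun z : E × E => z.1 - z.2) (ENNReal.ofReal p) π < δ := by
  simp only [wasserstein, iInf_lt_iff] at h
  obtain ⟨π, h₁, h₂, h₃⟩ := h
  refine ⟨π, ⟨?_⟩, h₁, h₂, h₃⟩
  have := measure_univ (μ := μ)
  rwa [← h₁, Measure.fst_univ] at this

/-- Gluing of two couplings along their common marginal. -/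
theorem exists_gluing {A B C : Type*} [MeasurableSpace A] [MeasurableSpace B] [MeasurableSpace C]
    [StandardBorelSpace C] [Nonempty C]
    (π₁ : Measure (A × B)) (π₂ : Measure (B × C)) [IsFiniteMeasure π₁] [IsFiniteMeasure π₂]
    (h : π₁.snd = π₂.fst) :
    ∃ ρ : Measure ((A × B) × C), ρ.map Prod.fst = π₁ ∧ ρ.map (fun z => (z.1.2, z.2)) = π₂ := by
  -- The third coordinate is drawn from the conditional law of `π₂` given the middle one, ignoring
  -- the first.
  refine ⟨π₁ ⊗ₘ (π₂.condKernel.comap Prod.snd measurable_snd), ?_, ?_⟩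
  · exact Measure.fst_compProd _ _
  · conv_rhs => rw [← π₂.disintegrate π₂.condKernel, ← h]
    ext s hs
    rw [Measure.map_apply (by fun_prop) hs, Measure.compProd_apply (by measurability),
      Measure.compProd_apply hs, Measure.snd, lintegral_map _ measurable_snd]
    · congr
    · exact Kernel.measurable_kernel_prodMk_left hs

/-- Couplings within `ε / 2` of the infima are glued along `ν`, and Minkowski's inequality is
applied on the glued space; no optimal coupling is needed. -/
theorem wasserstein_triangle {E : Type*} [NormedAddCommGroup E] [MeasurableSpace E] [BorelSpace E]
    [SecondCountableTopology E] [StandardBorelSpace E] {p : ℝ} (hp : 1 ≤ p) (μ ν ξ : Measure E)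
    [IsProbabilityMeasure μ] [IsProbabilityMeasure ν] :
    wasserstein p μ ξ ≤ wasserstein p μ ν + wasserstein p ν ξ := by
  refine ENNReal.le_of_forall_pos_le_add fun ε hε hlt => ?_
  have h₁ : wasserstein p μ ν < wasserstein p μ ν + (ε / 2 : ℝ≥0) :=
    ENNReal.lt_add_right (ne_top_of_le_ne_top hlt.ne le_self_add) (by simpa using hε.ne')
  have h₂ : wasserstein p ν ξ < wasserstein p ν ξ + (ε / 2 : ℝ≥0) :=
    ENNReal.lt_add_right (ne_top_of_le_ne_top hlt.ne le_add_self) (by simpa using hε.ne')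
  obtain ⟨π₁, _, a₁, b₁, c₁⟩ := exists_coupling_lt h₁
  obtain ⟨π₂, _, a₂, b₂, c₂⟩ := exists_coupling_lt h₂
  obtain ⟨ρ, r₁, r₂⟩ := exists_gluing π₁ π₂ (b₁.trans a₂.symm)
  have hm : ∀ {X : (E × E) × E → E} (_ : Measurable X), AEStronglyMeasurable X ρ :=
    fun h => h.aestronglyMeasurable
  have e₁ : ρ.map (fun z => z.1.1) = μ := by
    rw [← a₁, ← r₁, Measure.fst, Measure.map_map (by fun_prop) (by fun_prop)]; rfl
  have e₂ : ρ.map (fun z => z.2) = ξ := by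
    rw [← b₂, ← r₂, Measure.snd, Measure.map_map (by fun_prop) (by fun_prop)]; rfl
  have hle := wasserstein_map_le p ρ (X := fun z => z.1.1) (Y := fun z => z.2)
    (by fun_prop) (by fun_prop)
  rw [e₁, e₂] at hle
  refine hle.trans ?_
  have hsum : eLpNorm (fun z : (E × E) × E => z.1.1 - z.2) (ENNReal.ofReal p) ρ ≤
      eLpNorm (fun z : (E × E) × E => z.1.1 - z.1.2) (ENNReal.ofReal p) ρ +
      eLpNorm (fun z : (E × E) × E => z.1.2 - z.2) (ENNReal.ofReal p) ρ := by
    refine le_trans (le_of_eq ?_) (eLpNorm_add_le (hm (by fun_prop)) (hm (by fun_prop))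
      (by simpa using hp))
    congr 1
    ext z
    simp
  refine hsum.trans ?_
  rw [← r₁, eLpNorm_map_measure (by fun_prop) (by fun_prop)] at c₁
  rw [← r₂, eLpNorm_map_measure (by fun_prop) (by fun_prop)] at c₂
  refine (add_le_add c₁.le c₂.le).trans (le_of_eq ?_)
  have : (ε : ℝ≥0∞) = (ε / 2 : ℝ≥0) + (ε / 2 : ℝ≥0) := by
    rw [← ENNReal.coe_add, add_halves]
  rw [this]
  ring

/-- Fubini: an `L^q` bound conditional on the first coordinate is integrated. It serves with `γ` the
law of the Gaussian noise and `π` that of the preceding layer. -/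
theorem eLpNorm_prod_le_of_forall_le {A B F G : Type*} [MeasurableSpace A] [MeasurableSpace B]
    [NormedAddCommGroup F] [NormedAddCommGroup G] {q : ℝ≥0∞} (hq₀ : q ≠ 0) (hq : q ≠ ∞)
    {π : Measure A} {γ : Measure B} [SFinite γ] [SFinite π] {f : A × B → F} {g : A → G} {C : ℝ≥0}
    (hf : AEStronglyMeasurable f (π.prod γ))
    (h : ∀ᵐ z ∂π, eLpNorm (fun w => f (z, w)) q γ ≤ C * ‖g z‖ₑ) :
    eLpNorm f q (π.prod γ) ≤ C * eLpNorm g q π := by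
  have hq' : 0 < q.toReal := ENNReal.toReal_pos hq₀ hq
  have : C * eLpNorm g q π = eLpNorm (fun z => (C : ℝ) * ‖g z‖) q π := by
    rw [← eLpNorm_norm g]
    have := eLpNorm_const_smul (C : ℝ) (fun z => ‖g z‖) q π
    simpa [Pi.smul_def] using this.symm
  rw [this, eLpNorm_eq_lintegral_rpow_enorm_toReal hq₀ hq,
    eLpNorm_eq_lintegral_rpow_enorm_toReal hq₀ hq]
  gcongr
  rw [lintegral_prod _ (by fun_prop)]
  refine lintegral_mono_ae ?_
  filter_upwards [h] with z hz
  rw [eLpNorm_eq_lintegral_rpow_enorm_toReal hq₀ hq] at hz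
  have := ENNReal.rpow_le_rpow hz hq'.le
  rw [← ENNReal.rpow_mul, one_div_mul_cancel hq'.ne', ENNReal.rpow_one] at this
  simpa using this

end Wasserstein

/-! ### Even moments of i.i.d. sums in Hilbert spaces -/

section SumsOfIndependent

theorem pow_mul_pow_le_add {a b : ℝ} (ha : 0 ≤ a) (hb : 0 ≤ b) {m q M : ℕ} (hq : 2 ≤ q)
    (h : m + q = M + 2) : a ^ m * b ^ q ≤ a ^ M * b ^ 2 + b ^ (M + 2) := by
  rcases le_total a b with hab | hab
  · calc a ^ m * b ^ q ≤ b ^ m * b ^ q := by gcongr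
      _ = b ^ (M + 2) := by rw [← pow_add, h]
      _ ≤ _ := le_add_of_nonneg_left (by positivity)
  · obtain ⟨r, rfl⟩ := Nat.exists_eq_add_of_le hq
    obtain rfl : M = m + r := by omega
    calc a ^ m * b ^ (2 + r) = a ^ m * (b ^ r * b ^ 2) := by rw [← pow_add, add_comm]
      _ ≤ a ^ m * (a ^ r * b ^ 2) := by gcongr
      _ = a ^ (m + r) * b ^ 2 := by rw [pow_add]; ring
      _ ≤ _ := le_add_of_nonneg_right (by positivity)

/-- This expands `‖s + x‖ ^ (2k + 2)` with `a = ‖s‖`, `b = ‖x‖`, `i = ⟪s, x⟫`. The term linear in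
`i` is kept exactly, because its mean will vanish; everything else is at least quadratic in `b`. -/
theorem exists_sq_add_pow_le (k : ℕ) : ∃ C : ℝ, 0 ≤ C ∧ ∀ a b i : ℝ, 0 ≤ a → 0 ≤ b →
    |i| ≤ a * b → (a ^ 2 + 2 * i + b ^ 2) ^ (k + 1) ≤
      a ^ (2 * k + 2) + (2 * k + 2) * (a ^ (2 * k) * i) +
        C * (a ^ (2 * k) * b ^ 2 + b ^ (2 * k + 2)) := by
  induction k with
  | zero => exact ⟨1, zero_le_one, fun a b i _ _ _ => by norm_num; nlinarith [sq_nonneg b]⟩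
  | succ k ih =>
    obtain ⟨C, hC, ih⟩ := ih
    -- The witness adds up the coefficients of all monomials other than the two leading terms; each
    -- monomial is at most `T` by `t1`–`t7`.
    refine ⟨2 * C + 4 * (k + 1) + 4 * C + 1 + 2 * (k + 1) + 2 * C, by positivity,
      fun a b i ha hb hi => ?_⟩
    have hN : 0 ≤ a ^ 2 + 2 * i + b ^ 2 := by nlinarith [neg_abs_le i, sq_nonneg (a - b)]
    set T := a ^ (2 * (k + 1)) * b ^ 2 + b ^ (2 * (k + 1) + 2) with hT
    have hbase := mul_le_mul_of_nonneg_left (ih a b i ha hb hi) hN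
    have hmono : ∀ m q : ℕ, 2 ≤ q → m + q = 2 * (k + 1) + 2 → a ^ m * b ^ q ≤ T :=
      fun m q hq h => pow_mul_pow_le_add ha hb hq h
    have hi' : i ≤ a * b := (le_abs_self i).trans hi
    have hi2 : i ^ 2 ≤ (a * b) ^ 2 := by
      rw [← sq_abs]; gcongr
    have t1 : a ^ (2 * k + 2) * b ^ 2 ≤ T := hmono _ _ le_rfl (by ring)
    have t2 : a ^ 2 * b ^ (2 * k + 2) ≤ T := hmono _ _ (by omega) (by ring)
    have t3 : a ^ (2 * k) * i ^ 2 ≤ T :=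
      (mul_le_mul_of_nonneg_left hi2 (by positivity)).trans
        ((le_of_eq (by ring)).trans t1)
    have t4 : a ^ (2 * k) * b ^ 2 * i ≤ T :=
      (mul_le_mul_of_nonneg_left hi' (by positivity)).trans
        ((le_of_eq (by ring)).trans (hmono (2 * k + 1) 3 (by omega) (by ring)))
    have t5 : b ^ (2 * k + 2) * i ≤ T :=
      (mul_le_mul_of_nonneg_left hi' (by positivity)).trans
        ((le_of_eq (by ring)).trans (hmono 1 (2 * k + 3) (by omega) (by ring)))
    have t6 : a ^ (2 * k) * b ^ 4 ≤ T := hmono _ _ (by omega) (by ring)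
    have t7 : b ^ (2 * k + 4) ≤ T := by simpa using hmono 0 (2 * k + 4) (by omega) (by ring)
    have hk : (0 : ℝ) ≤ k := k.cast_nonneg
    have s1 := mul_le_mul_of_nonneg_left t1 hC
    have s2 := mul_le_mul_of_nonneg_left t2 hC
    have s3 := mul_le_mul_of_nonneg_left t3 (by positivity : (0 : ℝ) ≤ 4 * (k + 1))
    have s4 := mul_le_mul_of_nonneg_left t4 (by positivity : (0 : ℝ) ≤ 2 * C)
    have s4' := mul_le_mul_of_nonneg_left t4 (by positivity : (0 : ℝ) ≤ 2 * (k + 1))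
    have s5 := mul_le_mul_of_nonneg_left t5 (by positivity : (0 : ℝ) ≤ 2 * C)
    have s6 := mul_le_mul_of_nonneg_left t6 hC
    have s7 := mul_le_mul_of_nonneg_left t7 hC
    rw [pow_succ']
    push_cast
    refine hbase.trans ?_
    ring_nf at s1 s2 s3 s4 s4' s5 s6 s7 t1 ⊢
    linarith

/-- The linear term integrates to zero, since `x` is centered and independent of `s`. One more
summand thus costs only its variance times a lower moment of `s`, plus its own top moment. -/
theorem integral_norm_add_pow_le {A B H : Type*} [MeasurableSpace A] [MeasurableSpace B]
    [NormedAddCommGroup H] [InnerProductSpace ℝ H] [CompleteSpace H]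
    {ν : Measure A} {μ : Measure B} [IsProbabilityMeasure ν] [IsProbabilityMeasure μ]
    {s : A → H} {x : B → H} (hs : ∀ q : ℕ, MemLp s q ν) (hx : ∀ q : ℕ, MemLp x q μ)
    (hx₀ : ∫ z, x z ∂μ = 0) (k : ℕ) {C : ℝ}
    (hC : ∀ a b i : ℝ, 0 ≤ a → 0 ≤ b →
      |i| ≤ a * b → (a ^ 2 + 2 * i + b ^ 2) ^ (k + 1) ≤
        a ^ (2 * k + 2) + (2 * k + 2) * (a ^ (2 * k) * i) +
          C * (a ^ (2 * k) * b ^ 2 + b ^ (2 * k + 2))) :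
    ∫ z, ‖s z.1 + x z.2‖ ^ (2 * k + 2) ∂(ν.prod μ) ≤
      ∫ z, ‖s z‖ ^ (2 * k + 2) ∂ν +
        C * ((∫ z, ‖s z‖ ^ (2 * k) ∂ν) * (∫ z, ‖x z‖ ^ 2 ∂μ) + ∫ z, ‖x z‖ ^ (2 * k + 2) ∂μ) := by
  have is : ∀ q : ℕ, Integrable (fun z => ‖s z‖ ^ q) ν := fun q => (hs q).integrable_norm_pow'
  have ix : ∀ q : ℕ, Integrable (fun z => ‖x z‖ ^ q) μ := fun q => (hx q).integrable_norm_pow'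
  have ip : ∀ q r : ℕ, Integrable (fun z : A × B => ‖s z.1‖ ^ q * ‖x z.2‖ ^ r) (ν.prod μ) :=
    fun q r => (is q).mul_prod (ix r)
  have i1 : Integrable (fun z : A × B => ‖s z.1‖ ^ (2 * k + 2)) (ν.prod μ) := by
    simpa using ip (2 * k + 2) 0
  have i2 : Integrable (fun z : A × B => ‖x z.2‖ ^ (2 * k + 2)) (ν.prod μ) := by
    simpa using ip 0 (2 * k + 2)
  have ms : AEStronglyMeasurable (fun z : A × B => s z.1) (ν.prod μ) :=
    (hs 0).aestronglyMeasurable.comp_fst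
  have mx : AEStronglyMeasurable (fun z : A × B => x z.2) (ν.prod μ) :=
    (hx 0).aestronglyMeasurable.comp_snd
  have i3 : Integrable (fun z : A × B => ‖s z.1‖ ^ (2 * k) * inner ℝ (s z.1) (x z.2))
      (ν.prod μ) := by
    refine (ip (2 * k + 1) 1).mono' ((ms.norm.pow _).mul (ms.inner mx)) (ae_of_all _ fun z => ?_)
    rw [norm_mul, norm_pow, norm_norm, pow_succ, mul_assoc, pow_one]
    gcongr
    exact norm_inner_le_norm _ _
  have e3 : ∫ z : A × B, ‖s z.1‖ ^ (2 * k) * inner ℝ (s z.1) (x z.2) ∂(ν.prod μ) = 0 := by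
    rw [integral_prod _ i3]
    simp only [integral_const_mul]
    have : ∀ z, ∫ y, inner ℝ (s z) (x y) ∂μ = 0 := fun z => by
      rw [integral_inner (by simpa using (hx 1).integrable (by simp)), hx₀, inner_zero_right]
    simp [this]
  have ibound := (i1.add (i3.const_mul (2 * k + 2))).add (((ip (2 * k) 2).add i2).const_mul C)
  refine (integral_mono_of_nonneg (ae_of_all _ fun z => by positivity) ibound
    (ae_of_all _ fun z => ?_)).trans (le_of_eq ?_)
  · have := hC ‖s z.1‖ ‖x z.2‖ (inner ℝ (s z.1) (x z.2)) (norm_nonneg _) (norm_nonneg _)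
      (abs_real_inner_le_norm _ _)
    rw [← norm_add_sq_real, ← pow_mul, mul_add, mul_one] at this
    exact this
  · rw [integral_add' (i1.add (i3.const_mul _)) (((ip (2 * k) 2).add i2).const_mul C),
      integral_add' i1 (i3.const_mul _), integral_const_mul, e3, integral_const_mul,
      integral_add' (ip _ _) i2, integral_prod_mul (fun z => ‖s z‖ ^ (2 * k)) (fun z => ‖x z‖ ^ 2)]
    have h1 : ∫ z : A × B, ‖s z.1‖ ^ (2 * k + 2) ∂(ν.prod μ) = ∫ z, ‖s z‖ ^ (2 * k + 2) ∂ν := by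
      rw [integral_fun_fst (fun z => ‖s z‖ ^ (2 * k + 2))]; simp
    have h2 : ∫ z : A × B, ‖x z.2‖ ^ (2 * k + 2) ∂(ν.prod μ) = ∫ z, ‖x z‖ ^ (2 * k + 2) ∂μ := by
      rw [integral_fun_snd (fun z => ‖x z‖ ^ (2 * k + 2))]; simp
    rw [h1, h2]
    ring

/-- Even moments of a sum of i.i.d. centered vectors of a Hilbert space, with a constant that does
not depend on the dimension. -/
theorem exists_integral_norm_sum_pow_le.{u, v} (k : ℕ) : ∃ A : ℝ, 0 ≤ A ∧
    ∀ (E : Type u) [MeasurableSpace E] (μ : Measure E) [IsProbabilityMeasure μ] (H : Type v)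
      [NormedAddCommGroup H] [InnerProductSpace ℝ H] [CompleteSpace H] (x : E → H) (b : ℝ),
      (∀ q : ℕ, MemLp x q μ) → ∫ z, x z ∂μ = 0 → 0 ≤ b →
      (∀ j ≤ k, ∫ z, ‖x z‖ ^ (2 * j) ∂μ ≤ b ^ j) → ∀ n : ℕ,
      ∫ g, ‖∑ i, x (g i)‖ ^ (2 * k) ∂(Measure.pi fun _ : Fin n => μ) ≤ A * (n * b) ^ k := by
  induction k with
  | zero => exact ⟨1, zero_le_one, fun E _ μ _ H _ _ _ x b _ _ _ _ n => by simp⟩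
  | succ k ih =>
    obtain ⟨A, hA, ih⟩ := ih
    obtain ⟨C, hC₀, hC⟩ := exists_sq_add_pow_le k
    -- An inner induction on `n`: each summand adds at most `C (A n ^ k + 1) b ^ (k + 1)`, which is
    -- at most `C (A + 1) (n + 1) ^ k b ^ (k + 1)`, and `n (n + 1) ^ k + (n + 1) ^ k = (n + 1) ^ (k
    -- + 1)`.
    refine ⟨C * (A + 1), by positivity, fun E _ μ _ H _ _ _ x b hx hx₀ hb hbk n => ?_⟩
    induction n with
    | zero => simp
    | succ n ihn =>
      have hk := ih E μ H x b hx hx₀ hb (fun j hj => hbk j (by omega)) n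
      have hS : ∀ q : ℕ, MemLp (fun g : Fin n → E => ∑ i, x (g i)) q
          (Measure.pi fun _ : Fin n => μ) := fun q =>
        memLp_finsetSum _ fun i _ => (hx q).comp_measurePreserving (measurePreserving_eval _ i)
      have hstep := integral_norm_add_pow_le hS hx hx₀ k hC
      have hmp := (measurePreserving_piFinSuccAbove (fun _ : Fin (n + 1) => μ) 0)
      have hmp' := Measure.measurePreserving_swap.comp hmp
      have e : ∫ g, ‖∑ i, x (g i)‖ ^ (2 * (k + 1)) ∂(Measure.pi fun _ : Fin (n + 1) => μ) =
          ∫ z : (Fin n → E) × E, ‖∑ i, x (z.1 i) + x z.2‖ ^ (2 * k + 2)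
            ∂((Measure.pi fun _ : Fin n => μ).prod μ) := by
        have hemb : MeasurableEmbedding (Prod.swap ∘
            (MeasurableEquiv.piFinSuccAbove (fun _ : Fin (n + 1) => E) 0)) :=
          MeasurableEquiv.prodComm.measurableEmbedding.comp
            (MeasurableEquiv.piFinSuccAbove (fun _ : Fin (n + 1) => E) 0).measurableEmbedding
        rw [← hmp'.integral_comp hemb]
        refine integral_congr_ae (ae_of_all _ fun g => ?_)
        simp only [Fin.sum_univ_succ]
        rw [add_comm]
        rfl
      rw [e]
      refine hstep.trans ?_
      have b1 := hbk 1 (by omega)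
      have bk := hbk (k + 1) le_rfl
      rw [pow_one, mul_one] at b1
      have p1 : (∫ g, ‖∑ i, x (g i)‖ ^ (2 * k) ∂(Measure.pi fun _ : Fin n => μ)) *
          (∫ z, ‖x z‖ ^ 2 ∂μ) ≤ (A * (n * b) ^ k) * b :=
        mul_le_mul hk b1 (integral_nonneg fun _ => by positivity) (by positivity)
      have q1 : (n : ℝ) ^ k ≤ (n + 1) ^ k := by gcongr; linarith
      have q2 : (1 : ℝ) ≤ (n + 1) ^ k := one_le_pow₀ (by linarith [(n.cast_nonneg : (0 : ℝ) ≤ n)])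
      have q3 : C * (A * (n : ℝ) ^ k + 1) ≤ C * (A + 1) * (n + 1) ^ k := by
        rw [mul_assoc]
        gcongr
        nlinarith
      have q4 : (n : ℝ) * n ^ k ≤ n * (n + 1) ^ k := by gcongr
      calc _ ≤ C * (A + 1) * (n * b) ^ (k + 1) + C * ((A * (n * b) ^ k) * b + b ^ (k + 1)) :=
            add_le_add ihn (by gcongr; exact bk)
        _ = (C * (A + 1) * (n * n ^ k) + C * (A * (n : ℝ) ^ k + 1)) * b ^ (k + 1) := by
            rw [mul_pow, mul_pow]; ring
        _ ≤ (C * (A + 1) * (n * (n + 1) ^ k) + C * (A + 1) * (n + 1) ^ k) * b ^ (k + 1) := by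
            gcongr
        _ = _ := by push_cast; rw [mul_pow]; ring

theorem eLpNorm_le_ofReal_of_integral_le {Ω F : Type*} [MeasurableSpace Ω] [NormedAddCommGroup F]
    {ρ : Measure Ω} {f : Ω → F} {m : ℕ} (hm : m ≠ 0) (hf : MemLp f m ρ) {B : ℝ} (hB : 0 ≤ B)
    (h : ∫ z, ‖f z‖ ^ m ∂ρ ≤ B ^ m) : eLpNorm f m ρ ≤ ENNReal.ofReal B := by
  rw [hf.eLpNorm_eq_integral_rpow_norm (by exact_mod_cast hm) (by simp)]
  refine ENNReal.ofReal_le_ofReal ?_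
  simp only [ENNReal.toReal_natCast, Real.rpow_natCast]
  rw [Real.rpow_inv_le_iff_of_pos (integral_nonneg fun _ => by positivity) hB
    (by exact_mod_cast hm.bot_lt), Real.rpow_natCast]
  exact h

/-- `C` depends on `μ` and `k` only; `φ` and its target space enter through `D` alone. This gives
uniformity over all `T` and `h` in the kernel estimate. -/
theorem exists_eLpNorm_average_sub_le.{u, v} {E : Type u} [NormedAddCommGroup E]
    [MeasurableSpace E] (μ : Measure E) [IsProbabilityMeasure μ]
    (hμ : ∀ q : ℕ, MemLp (fun z : E => z) q μ) {k : ℕ} (hk : k ≠ 0) :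
    ∃ C : ℝ, 0 ≤ C ∧ ∀ (H : Type v) [NormedAddCommGroup H] [InnerProductSpace ℝ H]
      [CompleteSpace H] (φ : E → H) (D : ℝ), AEStronglyMeasurable φ μ → 0 ≤ D →
      (∀ z, ‖φ z‖ ≤ D * (1 + ‖z‖) ^ 2) → ∀ n : ℕ, 0 < n →
      eLpNorm (fun g : Fin n → E => (n : ℝ)⁻¹ • ∑ i, φ (g i) - ∫ z, φ z ∂μ) (2 * k : ℕ)
        (Measure.pi fun _ : Fin n => μ) ≤ ENNReal.ofReal (C * D / √(n : ℝ)) := by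
  obtain ⟨A, hA, hmain⟩ := exists_integral_norm_sum_pow_le.{u, v} k
  have hone : ∀ q : ℕ, MemLp (fun z : E => 1 + ‖z‖) q μ := fun q =>
    (memLp_const (1 : ℝ)).add (hμ q).norm
  have hsq : ∀ q : ℕ, MemLp (fun z : E => (1 + ‖z‖) ^ 2) q μ := fun q => by
    have h2 := hone (2 * q)
    have := h2.norm_rpow_div 2
    have e : ((2 * q : ℕ) : ℝ≥0∞) / 2 = q := by
      push_cast
      rw [mul_comm, ENNReal.mul_div_cancel_right (by simp) (by simp)]
    rw [e] at this
    refine this.congr_norm ((this.aestronglyMeasurable).congr (ae_of_all _ fun z => ?_))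
      (ae_of_all _ fun z => ?_) <;>
    · simp
  set m := ∫ z, (1 + ‖z‖) ^ 2 ∂μ
  have hm : 0 ≤ m := integral_nonneg fun _ => by positivity
  have hY : ∀ q : ℕ, MemLp (fun z : E => (1 + ‖z‖) ^ 2 + m) q μ := fun q =>
    (hsq q).add (memLp_const _)
  -- The summand `1` gives `B ≤ B ^ j` for `j ≥ 1`, so one number bounds all the moments in the form
  -- required by `hmain`.
  set B : ℝ := 1 + ∑ j ∈ Finset.range (k + 1), ∫ z, ((1 + ‖z‖) ^ 2 + m) ^ (2 * j) ∂μ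
  have hB1 : 1 ≤ B := le_add_of_nonneg_right
    (Finset.sum_nonneg fun j _ => integral_nonneg fun _ => by positivity)
  have hB0 : 0 ≤ B := zero_le_one.trans hB1
  -- `A + 1` replaces the `2k`-th root of `A`, thanks to `A ≤ (A + 1) ^ (2k)`.
  refine ⟨(A + 1) * √B, by positivity, fun H _ _ _ φ D hφ hD hbound n hn => ?_⟩
  have hφL : ∀ q : ℕ, MemLp φ q μ := fun q =>
    ((hsq q).const_mul D).mono hφ (ae_of_all _ fun z => (hbound z).trans (le_abs_self _))
  have hφi : Integrable φ μ := by simpa using (hφL 1).integrable (by simp)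
  have hsqi : Integrable (fun z : E => (1 + ‖z‖) ^ 2) μ := by
    simpa using (hsq 1).integrable (by simp)
  set e := ∫ z, φ z ∂μ
  have he : ‖e‖ ≤ D * m := by
    refine (norm_integral_le_of_norm_le (hsqi.const_mul D) (ae_of_all _ hbound)).trans ?_
    rw [integral_const_mul]
  set x : E → H := fun z => φ z - e
  have hx : ∀ q : ℕ, MemLp x q μ := fun q => (hφL q).sub (memLp_const _)
  have hx₀ : ∫ z, x z ∂μ = 0 := by
    rw [integral_sub hφi (integrable_const _)]; simp [e]
  have hxb : ∀ z, ‖x z‖ ≤ D * ((1 + ‖z‖) ^ 2 + m) := fun z =>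
    (norm_sub_le _ _).trans (by rw [mul_add]; exact add_le_add (hbound z) he)
  have hmom : ∀ j ≤ k, ∫ z, ‖x z‖ ^ (2 * j) ∂μ ≤ (D ^ 2 * B) ^ j := fun j hj => by
    rcases Nat.eq_zero_or_pos j with rfl | hj0
    · simp
    have i1 : Integrable (fun z : E => ((1 + ‖z‖) ^ 2 + m) ^ (2 * j)) μ := by
      have := (hY (2 * j)).integrable_norm_pow'
      refine this.congr (ae_of_all _ fun z => ?_)
      simp only [Real.norm_eq_abs]
      rw [abs_of_nonneg (by positivity)]
    calc ∫ z, ‖x z‖ ^ (2 * j) ∂μ ≤ ∫ z, D ^ (2 * j) * ((1 + ‖z‖) ^ 2 + m) ^ (2 * j) ∂μ := by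
          refine integral_mono_of_nonneg (ae_of_all _ fun _ => by positivity)
            (i1.const_mul _) (ae_of_all _ fun z => ?_)
          simp only
          rw [← mul_pow]
          exact pow_le_pow_left₀ (norm_nonneg _) (hxb z) _
      _ = (D ^ 2) ^ j * ∫ z, ((1 + ‖z‖) ^ 2 + m) ^ (2 * j) ∂μ := by
          rw [integral_const_mul, pow_mul]
      _ ≤ (D ^ 2) ^ j * B ^ j := by
          gcongr
          refine le_trans ?_ (le_self_pow₀ hB1 hj0.ne')
          have := Finset.single_le_sum (f := fun j => ∫ z : E, ((1 + ‖z‖) ^ 2 + m) ^ (2 * j) ∂μ)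
            (fun j _ => integral_nonneg fun _ => by positivity) (Finset.mem_range.2 (by omega : j < k + 1))
          exact this.trans (le_add_of_nonneg_left zero_le_one)
      _ = _ := by rw [mul_pow]
  have hfin := hmain E μ H x (D ^ 2 * B) hx hx₀ (by positivity) hmom n
  have hn' : (0 : ℝ) < n := by exact_mod_cast hn
  have hfun : (fun g : Fin n → E => (n : ℝ)⁻¹ • ∑ i, φ (g i) - e) =
      fun g => (n : ℝ)⁻¹ • ∑ i, x (g i) := by
    funext g
    simp only [x, Finset.sum_sub_distrib, Finset.sum_const, Finset.card_univ, Fintype.card_fin,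
      smul_sub]
    rw [← Nat.cast_smul_eq_nsmul ℝ, smul_smul, inv_mul_cancel₀ hn'.ne', one_smul]
  rw [hfun]
  refine eLpNorm_le_ofReal_of_integral_le (by omega) ?_ (by positivity) ?_
  · exact (memLp_finsetSum _ fun i _ =>
      (hx _).comp_measurePreserving (measurePreserving_eval (fun _ : Fin n => μ) i)).const_smul _
  · simp only [norm_smul, mul_pow]
    rw [integral_const_mul]
    have hsb : (√B) ^ (2 * k) = B ^ k := by rw [pow_mul, Real.sq_sqrt hB0]
    have hsn : (√(n : ℝ)) ^ (2 * k) = (n : ℝ) ^ k := by rw [pow_mul, Real.sq_sqrt hn'.le]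
    have hA1 : A ≤ (A + 1) ^ (2 * k) :=
      (by linarith : A ≤ A + 1).trans (le_self_pow₀ (by linarith) (by omega))
    calc ‖(n : ℝ)⁻¹‖ ^ (2 * k) * _ ≤ ‖(n : ℝ)⁻¹‖ ^ (2 * k) * (A * (n * (D ^ 2 * B)) ^ k) := by
          gcongr
      _ = A * (B ^ k * D ^ (2 * k) / n ^ k) := by
          rw [norm_inv, Real.norm_of_nonneg hn'.le, mul_pow, mul_pow, ← pow_mul, inv_pow,
            mul_comm 2 k, pow_mul (n : ℝ)]
          field_simp
      _ ≤ (A + 1) ^ (2 * k) * (B ^ k * D ^ (2 * k) / n ^ k) := by gcongr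
      _ = _ := by rw [div_pow, mul_pow, mul_pow, hsb, hsn]; ring

end SumsOfIndependent

/-! ### Linear images of Gaussian arrays -/

section GaussianArrays

/-- Minkowski's inequality in `L^k` for `‖X‖ ^ 2 = ∑ X_u ^ 2`: coordinatewise bounds combine as
squares, with no further dimensional constant. -/
theorem eLpNorm_euclidean_le {Ω U : Type*} [MeasurableSpace Ω] [Fintype U] {ρ : Measure Ω}
    {k : ℕ} (hk : k ≠ 0) {X : Ω → EuclideanSpace ℝ U} (hX : AEStronglyMeasurable X ρ)
    {r : U → ℝ} (hr : ∀ u, 0 ≤ r u)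
    (h : ∀ u, eLpNorm (fun ω => X ω u) (2 * k : ℕ) ρ ≤ ENNReal.ofReal (r u)) :
    eLpNorm X (2 * k : ℕ) ρ ≤ ENNReal.ofReal (√(∑ u, r u ^ 2)) := by
  have hexp : (k : ℝ≥0∞) * ENNReal.ofReal 2 = (2 * k : ℕ) := by
    push_cast
    rw [mul_comm]
    simp
  have key : ∀ f : Ω → ℝ,
      eLpNorm (fun ω => ‖f ω‖ ^ (2 : ℝ)) k ρ = eLpNorm f (2 * k : ℕ) ρ ^ (2 : ℝ) := fun f => by
    rw [eLpNorm_norm_rpow f two_pos, hexp]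
  have hu : ∀ u, AEStronglyMeasurable (fun ω => X ω u) ρ := fun u =>
    (EuclideanSpace.proj (𝕜 := ℝ) u).continuous.comp_aestronglyMeasurable hX
  have hsq : eLpNorm X (2 * k : ℕ) ρ ^ (2 : ℝ) ≤ ENNReal.ofReal (∑ u, r u ^ 2) := by
    rw [← eLpNorm_norm X]
    rw [← key]
    have : (fun ω => ‖‖X ω‖‖ ^ (2 : ℝ)) = ∑ u, fun ω => ‖X ω u‖ ^ (2 : ℝ) := by
      funext ω
      simp only [norm_norm, Real.rpow_two, EuclideanSpace.norm_sq_eq, Finset.sum_apply]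
    rw [this]
    refine (eLpNorm_sum_le (fun u _ => ?_) (by exact_mod_cast Nat.one_le_iff_ne_zero.2 hk)).trans ?_
    · simp only [Real.rpow_two]
      exact (hu u).norm.pow 2
    · rw [ENNReal.ofReal_sum_of_nonneg fun u _ => by positivity]
      refine Finset.sum_le_sum fun u _ => ?_
      rw [key, ENNReal.ofReal_pow (hr u), ENNReal.rpow_two]
      exact pow_le_pow_left' (h u) 2
  rw [← Real.sq_sqrt (by positivity : 0 ≤ ∑ u, r u ^ 2), ENNReal.ofReal_pow (by positivity),
    ENNReal.rpow_two] at hsq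
  exact (ENNReal.pow_le_pow_left_iff two_ne_zero).1 hsq

/-- The linear map sending an array `w` of row vectors to the array with rows `w[i, :] B`. -/
noncomputable def blockMap {m : ℕ} {ι S : Type*} [Fintype ι] (B : Matrix ι S ℝ)
    (w : Fin m × ι → ℝ) : EuclideanSpace ℝ (Fin m × S) :=
  WithLp.toLp 2 fun q => ∑ κ, w (q.1, κ) * B κ q.2

theorem measurable_blockMap {m : ℕ} {ι S : Type*} [Fintype ι] [Fintype S] (B : Matrix ι S ℝ) :
    Measurable (blockMap (m := m) B) := by
  unfold blockMap
  fun_prop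

/-- Arrays with independent centered Gaussian entries of variance `v`. -/
noncomputable def gaussianArray (m : ℕ) (ι : Type*) [Fintype ι] (v : ℝ≥0) :
    Measure (Fin m × ι → ℝ) :=
  Measure.pi fun _ => gaussianReal 0 v

instance (m : ℕ) (ι : Type*) [Fintype ι] (v : ℝ≥0) :
    IsProbabilityMeasure (gaussianArray m ι v) := by
  unfold gaussianArray
  infer_instance

theorem map_pi_gaussianReal_linear {κ : Type*} [Fintype κ] (v : ℝ≥0) (c : κ → ℝ) :
    (Measure.pi fun _ : κ => gaussianReal 0 v).map (fun w => ∑ u, w u * c u) =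
      (gaussianReal 0 1).map (fun z => √(v * ∑ u, c u ^ 2) * z) := by
  rw [gaussianReal_map_const_mul]
  refine Measure.ext_of_charFun (funext fun t => ?_)
  rw [charFun_gaussianReal, charFun_apply_real,
    integral_map (Measurable.aemeasurable (by fun_prop)) (by fun_prop)]
  have : ∀ w : κ → ℝ, Complex.exp (t * (∑ u, w u * c u : ℝ) * Complex.I) =
      ∏ u, Complex.exp (((t * c u : ℝ) : ℂ) * (w u : ℂ) * Complex.I) := fun w => by
    rw [← Complex.exp_sum]
    congr 1
    push_cast
    rw [Finset.mul_sum, Finset.sum_mul]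
    exact Finset.sum_congr rfl fun u _ => by ring
  simp only [this]
  rw [integral_fintype_prod_eq_prod
    (f := fun u (y : ℝ) => Complex.exp (((t * c u : ℝ) : ℂ) * (y : ℂ) * Complex.I))]
  simp only [← charFun_apply_real, charFun_gaussianReal]
  rw [← Complex.exp_sum]
  congr 1
  have hs : √(v * ∑ u, c u ^ 2) ^ 2 = v * ∑ u, c u ^ 2 := Real.sq_sqrt (by positivity)
  simp only [Complex.ofReal_zero, mul_zero, zero_mul, zero_sub, NNReal.coe_mk,
    mul_one, hs]
  push_cast
  rw [Finset.sum_neg_distrib, Finset.mul_sum, Finset.sum_mul, Finset.sum_div]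
  congr 1
  exact Finset.sum_congr rfl fun u _ => by ring

/-- Each entry is a centered Gaussian, so its `L^(2k)` norm is its standard deviation times a
constant depending on `k` only. -/
theorem exists_eLpNorm_blockMap_le (k : ℕ) (hk : k ≠ 0) :
    ∃ c : ℝ, 0 ≤ c ∧ ∀ (m : ℕ) {ι S : Type*} [Fintype ι] [Fintype S] (v : ℝ≥0)
      (B : Matrix ι S ℝ),
      eLpNorm (blockMap (m := m) B) (2 * k : ℕ) (gaussianArray m ι v) ≤
        ENNReal.ofReal (c * √(m * (v * ∑ κ, ∑ s, B κ s ^ 2))) := by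
  set c := (eLpNorm id (2 * k : ℕ) (gaussianReal 0 1)).toReal
  have hc : eLpNorm id (2 * k : ℕ) (gaussianReal 0 1) = ENNReal.ofReal c :=
    (ENNReal.ofReal_toReal (memLp_id_gaussianReal' _ (ENNReal.natCast_ne_top _)).2.ne).symm
  have hc0 : 0 ≤ c := ENNReal.toReal_nonneg
  refine ⟨c, hc0, fun m ι S _ _ v B => ?_⟩
  classical
  have hcoord : ∀ u : Fin m × S,
      eLpNorm (fun w => blockMap (m := m) B w u) (2 * k : ℕ) (gaussianArray m ι v) ≤
        ENNReal.ofReal (c * √(v * ∑ κ, B κ u.2 ^ 2)) := fun u => by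
    let b : Fin m × ι → ℝ := fun q => if q.1 = u.1 then B q.2 u.2 else 0
    have e1 : (fun w => blockMap (m := m) B w u) = id ∘ fun w => ∑ q, w q * b q := by
      funext w
      simp [blockMap, b, Fintype.sum_prod_type, Finset.sum_ite_irrel]
    have e2 : ∑ q, b q ^ 2 = ∑ κ, B κ u.2 ^ 2 := by
      simp [b, Fintype.sum_prod_type, Finset.sum_ite_irrel, ite_pow]
    rw [e1, ← eLpNorm_map_measure (by fun_prop) (Measurable.aemeasurable (by fun_prop)),
      gaussianArray,
      map_pi_gaussianReal_linear, e2, eLpNorm_map_measure (by fun_prop) (by fun_prop)]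
    have := eLpNorm_const_smul √(v * ∑ κ, B κ u.2 ^ 2) (id : ℝ → ℝ) (2 * k : ℕ)
      (gaussianReal 0 1)
    rw [hc] at this
    refine (le_of_eq this).trans (le_of_eq ?_)
    rw [mul_comm c, ENNReal.ofReal_mul (by positivity), Real.enorm_eq_ofReal (by positivity)]
  refine (eLpNorm_euclidean_le hk (measurable_blockMap B).aestronglyMeasurable
    (fun u => by positivity) hcoord).trans (ENNReal.ofReal_le_ofReal (le_of_eq ?_))
  have : ∑ u : Fin m × S, (c * √(v * ∑ κ, B κ u.2 ^ 2)) ^ 2 =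
      c ^ 2 * (m * (v * ∑ κ, ∑ s, B κ s ^ 2)) := by
    have : ∀ s, (c * √(v * ∑ κ, B κ s ^ 2)) ^ 2 = c ^ 2 * (v * ∑ κ, B κ s ^ 2) := fun s => by
      rw [mul_pow, Real.sq_sqrt (by positivity)]
    simp only [this, Fintype.sum_prod_type, Finset.sum_const, Finset.card_univ, Fintype.card_fin,
      nsmul_eq_mul]
    rw [Finset.sum_comm, ← Finset.mul_sum, ← Finset.mul_sum]
    ring
  rw [this, Real.sqrt_mul (by positivity), Real.sqrt_sq hc0]

theorem charFun_map_blockMap {m : ℕ} {ι S : Type*} [Fintype ι] [Fintype S] (v : ℝ≥0)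
    (B : Matrix ι S ℝ) (t : EuclideanSpace ℝ (Fin m × S)) :
    charFun ((gaussianArray m ι v).map (blockMap B)) t =
      Complex.exp (((-(∑ i, v * ∑ s, ∑ s', t (i, s) * t (i, s') * ∑ κ, B κ s * B κ s') / 2 : ℝ)) : ℂ) := by
  let c : Fin m × ι → ℝ := fun q => ∑ s, B q.2 s * t (q.1, s)
  have hin : ∀ w, inner ℝ (blockMap B w) t = ∑ q, w q * c q := fun w => by
    simp only [blockMap, PiLp.inner_apply, RCLike.inner_apply, conj_trivial,
      Fintype.sum_prod_type, c, Finset.mul_sum]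
    refine Finset.sum_congr rfl fun i _ => ?_
    rw [Finset.sum_comm]
    exact Finset.sum_congr rfl fun κ _ => Finset.sum_congr rfl fun s _ => by ring
  rw [charFun_apply, integral_map (measurable_blockMap B).aemeasurable (by fun_prop)]
  -- The characteristic function at `t` is that of the scalar Gaussian `⟪blockMap B w, t⟫` at `1`.
  have h1 := charFun_apply_real (μ := (gaussianArray m ι v).map fun w => ∑ q, w q * c q) 1
  rw [integral_map (Measurable.aemeasurable (by fun_prop)) (by fun_prop), gaussianArray, map_pi_gaussianReal_linear,
    gaussianReal_map_const_mul, charFun_gaussianReal] at h1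
  simp only [hin, gaussianArray]
  simp only [Complex.ofReal_one, one_mul] at h1
  rw [← h1]
  congr 1
  have hs : √(v * ∑ u, c u ^ 2) ^ 2 = v * ∑ u, c u ^ 2 := Real.sq_sqrt (by positivity)
  have hc : ∑ u, c u ^ 2 =
      ∑ i, ∑ s, ∑ s', t (i, s) * t (i, s') * ∑ κ, B κ s * B κ s' := by
    simp only [Fintype.sum_prod_type, c, sq, Finset.sum_mul_sum]
    simp only [Finset.mul_sum]
    refine Finset.sum_congr rfl fun i _ => ?_
    rw [Finset.sum_comm]
    refine Finset.sum_congr rfl fun s _ => ?_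
    rw [Finset.sum_comm]
    exact Finset.sum_congr rfl fun s' _ => Finset.sum_congr rfl fun κ _ => by ring
  simp only [Complex.ofReal_zero, mul_zero, zero_mul, zero_sub, NNReal.coe_mk,
    mul_one, hs]
  simp only [← Finset.mul_sum, hc]
  push_cast
  ring

/-- The characteristic function sees `B` only through `v BᵀB`. This lets the tall matrix of
activations be replaced by any other factor of the same covariance. -/
theorem map_blockMap_congr {m : ℕ} {ι ι' S : Type*} [Fintype ι] [Fintype ι'] [Fintype S]
    {v v' : ℝ≥0} {B : Matrix ι S ℝ} {B' : Matrix ι' S ℝ}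
    (h : ∀ s t, v * ∑ κ, B κ s * B κ t = v' * ∑ κ, B' κ s * B' κ t) :
    (gaussianArray m ι v).map (blockMap B) = (gaussianArray m ι' v').map (blockMap B') := by
  have := Measure.isProbabilityMeasure_map (μ := gaussianArray m ι v)
    (measurable_blockMap B).aemeasurable
  have := Measure.isProbabilityMeasure_map (μ := gaussianArray m ι' v')
    (measurable_blockMap B').aemeasurable
  refine Measure.ext_of_charFun (funext fun t => ?_)
  rw [charFun_map_blockMap, charFun_map_blockMap]
  congr 6
  funext i
  simp only [Finset.mul_sum (ι := S)]
  refine Finset.sum_congr rfl fun s _ => Finset.sum_congr rfl fun s' _ => ?_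
  linear_combination (t (i, s) * t (i, s')) * h s s'

/-- Any factorisation `K = BᵀB` will do, so `K` may be singular. -/
theorem map_pi_multivariateGaussian {m : ℕ} {S : Type*} [Fintype S] [DecidableEq S]
    {K : Matrix S S ℝ} (hK : K.PosSemidef) {ι : Type*} [Fintype ι] {B : Matrix ι S ℝ}
    (hB : ∀ s t, ∑ κ, B κ s * B κ t = K s t) :
    ((Measure.pi fun _ : Fin m => multivariateGaussian 0 K).map
      fun g => WithLp.toLp 2 fun q : Fin m × S => g q.1 q.2) =
    (gaussianArray m ι 1).map (blockMap B) := by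
  have hmeas : Measurable fun g : Fin m → EuclideanSpace ℝ S =>
      (WithLp.toLp 2 fun q : Fin m × S => g q.1 q.2 : EuclideanSpace ℝ (Fin m × S)) := by
    fun_prop
  have := Measure.isProbabilityMeasure_map (μ := gaussianArray m ι 1)
    (measurable_blockMap B).aemeasurable
  have := Measure.isProbabilityMeasure_map
    (μ := Measure.pi fun _ : Fin m => multivariateGaussian 0 K) hmeas.aemeasurable
  refine Measure.ext_of_charFun (funext fun t => ?_)
  rw [charFun_map_blockMap, charFun_apply, integral_map hmeas.aemeasurable (by fun_prop)]
  have hin : ∀ g : Fin m → EuclideanSpace ℝ S, Complex.exp (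
      (inner ℝ (WithLp.toLp 2 fun q : Fin m × S => g q.1 q.2 : EuclideanSpace ℝ (Fin m × S)) t : ℝ)
        * Complex.I) = ∏ i, Complex.exp ((inner ℝ (g i) (row t i) : ℝ) * Complex.I) := fun g => by
    rw [← Complex.exp_sum, ← Finset.sum_mul, ← Complex.ofReal_sum]
    simp [PiLp.inner_apply, Fintype.sum_prod_type, row]
  simp only [hin]
  rw [integral_fintype_prod_eq_prod (f := fun i (z : EuclideanSpace ℝ S) =>
    Complex.exp ((inner ℝ z (row t i) : ℝ) * Complex.I))]
  simp only [← charFun_apply, charFun_multivariateGaussian hK]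
  rw [← Complex.exp_sum]
  congr 1
  simp only [hB, inner_zero_right, Complex.ofReal_zero, zero_mul, zero_sub, dotProduct,
    Matrix.mulVec, row, NNReal.coe_one, one_mul]
  push_cast
  rw [Finset.sum_neg_distrib, neg_div, Finset.sum_div]
  congr 1
  refine Finset.sum_congr rfl fun i _ => ?_
  congr 1
  refine Finset.sum_congr rfl fun s _ => ?_
  rw [Finset.mul_sum]
  exact Finset.sum_congr rfl fun s' _ => by ring

end GaussianArrays

/-! ### Square roots and pseudo-inverses of positive semidefinite matrices -/

section LinearAlgebra

open Matrix

/-- Continuity is what makes the coupling through a random square root measurable. -/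
theorem exists_continuous_posSemidef_sqrt {S X : Type*} [Fintype S] [DecidableEq S]
    [TopologicalSpace X] {M : X → Matrix S S ℝ} (hM : Continuous M)
    (hp : ∀ x, (M x).PosSemidef) :
    ∃ N : X → Matrix S S ℝ, Continuous N ∧ (∀ x, (N x).PosSemidef) ∧ ∀ x, N x * N x = M x := by
  open scoped MatrixOrder Matrix.Norms.L2Operator in
  exact ⟨fun x => CFC.sqrt (M x),
    CFC.continuousOn_sqrt.comp_continuous hM fun x => (hp x).nonneg,
    fun x => (CFC.sqrt_nonneg (M x)).posSemidef,
    fun x => CFC.sqrt_mul_sqrt_self (M x) (hp x).nonneg⟩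

/-- A square root factor of a positive semidefinite matrix, together with a pseudo-inverse. -/
theorem Matrix.PosSemidef.exists_mul_transpose_pseudoinverse {S : Type*} [Fintype S]
    [DecidableEq S] {K : Matrix S S ℝ} (hK : K.PosSemidef) :
    ∃ R Q : Matrix S S ℝ, R * Rᵀ = K ∧ R * Q * R = R ∧ (Q * R)ᵀ = Q * R := by
  set U : Matrix S S ℝ := (hK.1.eigenvectorUnitary).1 with hU
  set d := hK.1.eigenvalues with hd
  have hUU : Uᵀ * U = 1 := by
    have := Unitary.coe_star_mul_self hK.1.eigenvectorUnitary
    rwa [star_eq_conjTranspose, conjTranspose_eq_transpose_of_trivial] at this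
  have hs := hK.1.spectral_theorem
  rw [Unitary.conjStarAlgAut_apply, star_eq_conjTranspose,
    conjTranspose_eq_transpose_of_trivial] at hs
  have hd0 : ∀ i, 0 ≤ d i := hK.eigenvalues_nonneg
  have e : diagonal (fun i => (√(d i))⁻¹) * Uᵀ * (U * diagonal fun i => √(d i)) =
      diagonal fun i => (√(d i))⁻¹ * √(d i) := by
    rw [Matrix.mul_assoc, ← Matrix.mul_assoc Uᵀ, hUU, Matrix.one_mul, diagonal_mul_diagonal]
  -- Since `0⁻¹ = 0`, the product `Q * R` is the diagonal projection onto the nonzero eigenvalues.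
  refine ⟨U * diagonal fun i => √(d i), diagonal (fun i => (√(d i))⁻¹) * Uᵀ, ?_, ?_, ?_⟩
  · conv_rhs => rw [hs]
    rw [transpose_mul, diagonal_transpose, Matrix.mul_assoc, ← Matrix.mul_assoc (diagonal _),
      diagonal_mul_diagonal, ← Matrix.mul_assoc]
    simp only [Real.mul_self_sqrt (hd0 _)]
    rfl
  · rw [Matrix.mul_assoc, e, Matrix.mul_assoc, diagonal_mul_diagonal]
    congr 2
    funext i
    rcases eq_or_ne (√(d i)) 0 with h | h
    · simp [h]
    · field_simp
  · rw [e, diagonal_transpose]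

/-- On each column, `N * N - 1 = N (N - 1) + (N - 1)` sends the basis vector to `N u + u` with `u` a
column of `N - 1`, and `⟪u, N u⟫ ≥ 0`. The square root is therefore a contraction towards the
identity, even when `N` is singular. -/
theorem sum_sq_sqrt_sub_one_le {S : Type*} [Fintype S] [DecidableEq S] {N : Matrix S S ℝ}
    (hN : N.PosSemidef) :
    ∑ s, ∑ t, (N - 1) s t ^ 2 ≤ ∑ s, ∑ t, (N * N - 1) s t ^ 2 := by
  rw [Finset.sum_comm, Finset.sum_comm (f := fun s t => (N * N - 1) s t ^ 2)]
  refine Finset.sum_le_sum fun t _ => ?_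
  set u : S → ℝ := fun s => (N - 1) s t with hu
  have hv : ∀ s, (N * N - 1) s t = (N *ᵥ u) s + u s := fun s => by
    have : N * N - 1 = N * (N - 1) + (N - 1) := by noncomm_ring
    rw [this, Matrix.add_apply, Matrix.mul_apply]
    rfl
  have hpos : 0 ≤ ∑ s, u s * (N *ᵥ u) s := by
    have := hN.dotProduct_mulVec_nonneg u
    simpa [dotProduct] using this
  have : ∑ s, (N * N - 1) s t ^ 2 =
      ∑ s, u s ^ 2 + 2 * ∑ s, u s * (N *ᵥ u) s + ∑ s, (N *ᵥ u) s ^ 2 := by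
    rw [Finset.mul_sum, ← Finset.sum_add_distrib, ← Finset.sum_add_distrib]
    exact Finset.sum_congr rfl fun s _ => by rw [hv]; ring
  rw [this]
  have : 0 ≤ ∑ s, (N *ᵥ u) s ^ 2 := by positivity
  linarith

theorem sum_sq_mul_le {S T U : Type*} [Fintype S] [Fintype T] [Fintype U] (A : Matrix S T ℝ)
    (B : Matrix T U ℝ) :
    ∑ s, ∑ u, (A * B) s u ^ 2 ≤ (∑ s, ∑ t, A s t ^ 2) * ∑ t, ∑ u, B t u ^ 2 := by
  rw [Finset.sum_comm (f := fun t u => B t u ^ 2), Finset.sum_mul_sum]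
  exact Finset.sum_le_sum fun s _ => Finset.sum_le_sum fun u _ =>
    Finset.sum_mul_sq_le_sq_mul_sq _ _ _

end LinearAlgebra

/-! ### Functions of quadratic growth -/

section QuadraticGrowth

variable {E : Type*} [NormedAddCommGroup E]

/-- Growth at most quadratic at infinity. -/
def QuadraticGrowth {F : Type*} [NormedAddCommGroup F] (f : E → F) : Prop :=
  ∃ D : ℝ, 0 ≤ D ∧ ∀ z, ‖f z‖ ≤ D * (1 + ‖z‖) ^ 2

theorem quadraticGrowth_const {F : Type*} [NormedAddCommGroup F] (c : F) :
    QuadraticGrowth fun _ : E => c :=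
  ⟨‖c‖, norm_nonneg _, fun z => le_mul_of_one_le_right (norm_nonneg _)
    (one_le_pow₀ (by linarith [norm_nonneg z]))⟩

theorem QuadraticGrowth.add {F : Type*} [NormedAddCommGroup F] {f g : E → F}
    (hf : QuadraticGrowth f) (hg : QuadraticGrowth g) :
    QuadraticGrowth fun z => f z + g z := by
  obtain ⟨C, hC, hf⟩ := hf
  obtain ⟨D, hD, hg⟩ := hg
  exact ⟨C + D, add_nonneg hC hD, fun z =>
    (norm_add_le _ _).trans (by rw [add_mul]; exact add_le_add (hf z) (hg z))⟩

theorem QuadraticGrowth.sum {F ι : Type*} [NormedAddCommGroup F] (s : Finset ι) {f : ι → E → F}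
    (hf : ∀ i ∈ s, QuadraticGrowth (f i)) : QuadraticGrowth fun z => ∑ i ∈ s, f i z := by
  classical
  induction s using Finset.induction_on with
  | empty => simpa using quadraticGrowth_const (E := E) (0 : F)
  | insert i s hi ih =>
    simp only [Finset.sum_insert hi]
    exact (hf i (by simp)).add (ih fun j hj => hf j (by simp [hj]))

theorem QuadraticGrowth.mul {f g : E → ℝ} {C D : ℝ} (hf : ∀ z, |f z| ≤ C * (1 + ‖z‖))
    (hg : ∀ z, |g z| ≤ D * (1 + ‖z‖)) : QuadraticGrowth fun z => f z * g z := by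
  have hC : 0 ≤ C := by simpa using (abs_nonneg _).trans (hf 0)
  have hD : 0 ≤ D := by simpa using (abs_nonneg _).trans (hg 0)
  refine ⟨C * D, by positivity, fun z => ?_⟩
  rw [norm_mul, Real.norm_eq_abs, Real.norm_eq_abs]
  calc _ ≤ (C * (1 + ‖z‖)) * (D * (1 + ‖z‖)) :=
        mul_le_mul (hf z) (hg z) (abs_nonneg _) (by positivity)
    _ = _ := by ring

theorem quadraticGrowth_euclidean {U : Type*} [Fintype U] {f : E → EuclideanSpace ℝ U}
    (h : ∀ u, QuadraticGrowth fun z => f z u) : QuadraticGrowth f := by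
  choose D hD hf using h
  refine ⟨∑ u, D u, Finset.sum_nonneg fun u _ => hD u, fun z => ?_⟩
  rw [EuclideanSpace.norm_eq, Finset.sum_mul]
  refine Real.sqrt_le_iff.2 ⟨Finset.sum_nonneg fun u _ => mul_nonneg (hD u) (by positivity), ?_⟩
  refine (Finset.sum_le_sum fun u _ => pow_le_pow_left₀ (norm_nonneg _) (hf u z) 2).trans ?_
  exact Finset.sum_sq_le_sq_sum_of_nonneg fun u _ => mul_nonneg (hD u) (by positivity)

theorem QuadraticGrowth.integrable [MeasurableSpace E] {F : Type*} [NormedAddCommGroup F]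
    {μ : Measure E} [IsProbabilityMeasure μ] (hμ : MemLp (fun z : E => z) 2 μ) {f : E → F}
    (hf : QuadraticGrowth f) (hm : AEStronglyMeasurable f μ) : Integrable f μ := by
  obtain ⟨D, -, hD⟩ := hf
  have h1 : MemLp (fun z : E => 1 + ‖z‖) 2 μ := (memLp_const (1 : ℝ)).add hμ.norm
  exact (h1.integrable_sq.const_mul D).mono' hm (ae_of_all _ hD)

end QuadraticGrowth

/-! ### The second moment of the activations -/

section TracedSecondMoment

open Matrix

variable {S₀ S₁ : Type*} [Fintype S₀] [Fintype S₁] {m : ℕ}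
  {σ : EuclideanSpace ℝ S₀ → EuclideanSpace ℝ (Fin m × S₁)}

theorem LipschitzWith.exists_norm_le {E F : Type*} [NormedAddCommGroup E] [NormedAddCommGroup F]
    {f : E → F} {κ : ℝ≥0} (hf : LipschitzWith κ f) (z : E) :
    ‖f z‖ ≤ (‖f 0‖ + κ) * (1 + ‖z‖) := by
  have h := hf.dist_le_mul z 0
  rw [dist_zero_right, dist_eq_norm] at h
  have := norm_le_norm_add_norm_sub' (f z) (f 0)
  nlinarith [norm_nonneg z, norm_nonneg (f 0), κ.coe_nonneg]

theorem LipschitzWith.abs_sum_mul_apply_le {κ : ℝ≥0} (hσ : LipschitzWith κ σ) (c : S₁ → ℝ)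
    (α : Fin m) (z : EuclideanSpace ℝ S₀) :
    |∑ s, c s * σ z (α, s)| ≤ ((∑ s, |c s|) * (‖σ 0‖ + κ)) * (1 + ‖z‖) := by
  refine (Finset.abs_sum_le_sum_abs _ _).trans ?_
  rw [Finset.sum_mul, Finset.sum_mul]
  refine Finset.sum_le_sum fun s _ => ?_
  rw [abs_mul, mul_assoc]
  refine mul_le_mul_of_nonneg_left ?_ (abs_nonneg _)
  exact (PiLp.norm_apply_le (σ z) (α, s)).trans (hσ.exists_norm_le z)

/-- Taking `c = d` shows positivity, and a vanishing value then forces the corresponding linear form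
of the activations to vanish almost surely. -/
theorem sum_mul_sum_tracedSecondMoment {κ : ℝ≥0} (hσ : LipschitzWith κ σ)
    {μ : Measure (EuclideanSpace ℝ S₀)} [IsProbabilityMeasure μ]
    (hμ : MemLp (fun z => z) 2 μ) (c d : S₁ → ℝ) :
    ∑ s, ∑ t, c s * d t * tracedSecondMoment σ μ s t =
      ∑ α, ∫ z, (∑ s, c s * σ z (α, s)) * (∑ t, d t * σ z (α, t)) ∂μ := by
  have hi : ∀ (α : Fin m) (s t : S₁), Integrable (fun z => σ z (α, s) * σ z (α, t)) μ :=
    fun α s t => by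
      have h : ∀ s z, |σ z (α, s)| ≤ (‖σ 0‖ + κ) * (1 + ‖z‖) := fun s z =>
        (PiLp.norm_apply_le (σ z) (α, s)).trans (hσ.exists_norm_le z)
      have := hσ.continuous
      exact (QuadraticGrowth.mul (h s) (h t)).integrable hμ
        (Continuous.aestronglyMeasurable (by fun_prop))
  simp only [tracedSecondMoment, Matrix.of_apply, Finset.sum_mul_sum]
  have : ∀ α, ∫ z, ∑ s, ∑ t, (c s * σ z (α, s)) * (d t * σ z (α, t)) ∂μ =
      ∑ s, ∑ t, c s * d t * ∫ z, σ z (α, s) * σ z (α, t) ∂μ := fun α => by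
    have e : ∀ (z : EuclideanSpace ℝ S₀) s t, (c s * σ z (α, s)) * (d t * σ z (α, t)) =
        c s * d t * (σ z (α, s) * σ z (α, t)) := fun z s t => by ring
    simp only [e]
    rw [integral_finsetSum _ fun s _ => integrable_finsetSum _ fun t _ => (hi α s t).const_mul _]
    refine Finset.sum_congr rfl fun s _ => ?_
    rw [integral_finsetSum _ fun t _ => (hi α s t).const_mul _]
    exact Finset.sum_congr rfl fun t _ => integral_const_mul _ _
  simp only [this, Finset.mul_sum]
  rw [Finset.sum_comm]
  conv_rhs => rw [Finset.sum_comm]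
  rw [Finset.sum_comm]
  refine Finset.sum_congr rfl fun s _ => ?_
  rw [Finset.sum_comm]

theorem posSemidef_tracedSecondMoment {κ : ℝ≥0} (hσ : LipschitzWith κ σ)
    {μ : Measure (EuclideanSpace ℝ S₀)} [IsProbabilityMeasure μ]
    (hμ : MemLp (fun z => z) 2 μ) : (tracedSecondMoment σ μ).PosSemidef := by
  refine PosSemidef.of_dotProduct_mulVec_nonneg ?_ fun c => ?_
  · ext s t
    simp [tracedSecondMoment, mul_comm]
  · have := sum_mul_sum_tracedSecondMoment hσ hμ c c
    have e : star c ⬝ᵥ tracedSecondMoment σ μ *ᵥ c =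
        ∑ s, ∑ t, c s * c t * tracedSecondMoment σ μ s t := by
      simp only [dotProduct, mulVec, Finset.mul_sum, star_trivial]
      exact Finset.sum_congr rfl fun s _ => Finset.sum_congr rfl fun t _ => by ring
    rw [e, this]
    exact Finset.sum_nonneg fun α _ => integral_nonneg fun z => mul_self_nonneg _

/-- Almost surely, the activations lie in the range of their second moment. -/
theorem ae_mulVec_eq_of_mul_tracedSecondMoment_eq [DecidableEq S₁] {κ : ℝ≥0}
    (hσ : LipschitzWith κ σ)
    {μ : Measure (EuclideanSpace ℝ S₀)} [IsProbabilityMeasure μ]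
    (hμ : MemLp (fun z => z) 2 μ) {P : Matrix S₁ S₁ ℝ}
    (hP : P * tracedSecondMoment σ μ = tracedSecondMoment σ μ) :
    ∀ᵐ z ∂μ, ∀ α, P *ᵥ (fun s => σ z (α, s)) = fun s => σ z (α, s) := by
  have hσc := hσ.continuous
  have key : ∀ s, ∀ᵐ z ∂μ, ∀ α, ∑ t, (P - 1) s t * σ z (α, t) = 0 := fun s => by
    -- This is the second moment of coordinate `s` of `(P - 1)` applied to the activations, summed
    -- over `α`. It vanishes because `(P - 1) K = 0`, hence so does each of its nonnegative terms.
    have h0 : ∑ t, ∑ u, (P - 1) s t * (P - 1) s u * tracedSecondMoment σ μ t u = 0 := by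
      have h1 : ∀ u, ∑ t, (P - 1) s t * tracedSecondMoment σ μ t u = 0 := fun u => by
        have : ((P - 1) * tracedSecondMoment σ μ) s u = 0 := by
          rw [Matrix.sub_mul, hP, Matrix.one_mul, sub_self, Matrix.zero_apply]
        rwa [Matrix.mul_apply] at this
      rw [Finset.sum_comm]
      refine Finset.sum_eq_zero fun u _ => ?_
      rw [← mul_zero ((P - 1) s u), ← h1 u, Finset.mul_sum]
      exact Finset.sum_congr rfl fun t _ => by ring
    rw [sum_mul_sum_tracedSecondMoment hσ hμ] at h0
    rw [Finset.sum_eq_zero_iff_of_nonneg fun α _ => integral_nonneg fun z => mul_self_nonneg _]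
      at h0
    rw [ae_all_iff]
    intro α
    have h2 := h0 α (Finset.mem_univ _)
    have hb := hσ.abs_sum_mul_apply_le ((P - 1) s) α
    rw [integral_eq_zero_iff_of_nonneg (fun z => mul_self_nonneg _)
      ((QuadraticGrowth.mul hb hb).integrable hμ
        (Continuous.aestronglyMeasurable (by fun_prop)))] at h2
    filter_upwards [h2] with z hz
    exact mul_self_eq_zero.1 hz
  filter_upwards [ae_all_iff.2 key] with z hz α
  funext s
  have := hz s α
  simp only [Matrix.sub_apply, sub_mul, Finset.sum_sub_distrib, Matrix.one_apply, ite_mul, one_mul,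
    zero_mul, Finset.sum_ite_eq, Finset.mem_univ, if_true, sub_eq_zero] at this
  exact this

end TracedSecondMoment

/-! ### One layer: stability and Gaussian approximation -/

section Layer

open Matrix

theorem continuous_row {n : ℕ} {S : Type*} (i : Fin n) :
    Continuous fun A : EuclideanSpace ℝ (Fin n × S) => row A i := by
  unfold _root_.row
  fun_prop

theorem sum_norm_row_sq {n : ℕ} {S : Type*} [Fintype S] (A : EuclideanSpace ℝ (Fin n × S)) :
    ∑ i, ‖row A i‖ ^ 2 = ‖A‖ ^ 2 := by
  simp [EuclideanSpace.norm_sq_eq, _root_.row, Fintype.sum_prod_type]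

theorem row_sub {n : ℕ} {S : Type*} (A B : EuclideanSpace ℝ (Fin n × S)) (i : Fin n) :
    row A i - row B i = row (A - B) i := rfl

/-- The array with the given rows. -/
def stackRows {n : ℕ} {S : Type*} (g : Fin n → EuclideanSpace ℝ S) :
    EuclideanSpace ℝ (Fin n × S) :=
  WithLp.toLp 2 fun q => g q.1 q.2

theorem measurable_stackRows {n : ℕ} {S : Type*} [Fintype S] :
    Measurable (stackRows : (Fin n → EuclideanSpace ℝ S) → _) := by
  unfold stackRows
  fun_prop

theorem row_stackRows {n : ℕ} {S : Type*} (g : Fin n → EuclideanSpace ℝ S) (i : Fin n) :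
    row (stackRows g) i = g i := rfl

variable {S₀ S₁ : Type*} [Fintype S₀] [Fintype S₁] {m n : ℕ}
  (σ : EuclideanSpace ℝ S₀ → EuclideanSpace ℝ (Fin m × S₁))

/-- The activations of all neurons of a layer, as a matrix. -/
def activationMatrix (A : EuclideanSpace ℝ (Fin n × S₀)) : Matrix (Fin n × Fin m) S₁ ℝ :=
  Matrix.of fun q s => σ (row A q.1) (q.2, s)

/-- The passage from one layer to the next, with given weights. -/
noncomputable def layerMap {n' : ℕ}
    (z : EuclideanSpace ℝ (Fin n × S₀) × (Fin n' × (Fin n × Fin m) → ℝ)) :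
    EuclideanSpace ℝ (Fin n' × S₁) :=
  blockMap (activationMatrix σ z.1) z.2

/-- The law of the next layer, of width `n'`, when the current layer has law `ν`. -/
noncomputable def layerLaw (n' : ℕ) (ν : Measure (EuclideanSpace ℝ (Fin n × S₀))) :
    Measure (EuclideanSpace ℝ (Fin n' × S₁)) :=
  (ν.prod (gaussianArray n' (Fin n × Fin m) (n : ℝ≥0)⁻¹)).map (layerMap σ)

variable {σ}

theorem measurable_layerMap {n' : ℕ} (hσ : Continuous σ) :
    Measurable (layerMap (n := n) (n' := n') σ) := by
  have h : ∀ i : Fin n, Continuous fun A : EuclideanSpace ℝ (Fin n × S₀) => row A i :=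
    continuous_row
  unfold layerMap blockMap activationMatrix
  simp only [Matrix.of_apply]
  fun_prop

theorem isProbabilityMeasure_layerLaw {n' : ℕ} (hσ : Continuous σ)
    (ν : Measure (EuclideanSpace ℝ (Fin n × S₀))) [IsProbabilityMeasure ν] :
    IsProbabilityMeasure (layerLaw σ n' ν) :=
  Measure.isProbabilityMeasure_map (measurable_layerMap hσ).aemeasurable

theorem layerLaw_map {Ω : Type*} [MeasurableSpace Ω] {n' : ℕ} (hσ : Continuous σ)
    (π : Measure Ω) [SFinite π] {f : Ω → EuclideanSpace ℝ (Fin n × S₀)} (hf : Measurable f) :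
    layerLaw σ n' (π.map f) = (π.prod (gaussianArray n' (Fin n × Fin m) (n : ℝ≥0)⁻¹)).map
      fun z => layerMap σ (f z.1, z.2) := by
  have h := Measure.map_prod_map π (gaussianArray n' (Fin n × Fin m) (n : ℝ≥0)⁻¹) hf measurable_id
  rw [Measure.map_id] at h
  rw [layerLaw, h, Measure.map_map (measurable_layerMap hσ) (hf.prodMap measurable_id)]
  rfl

theorem measurable_blockMap_prod {X ι S : Type*} [MeasurableSpace X] [Fintype ι] [Fintype S]
    {m : ℕ} {B : X → Matrix ι S ℝ} (hB : ∀ κ s, Measurable fun x => B x κ s) :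
    Measurable fun z : X × (Fin m × ι → ℝ) => blockMap (B z.1) z.2 := by
  refine (WithLp.measurable_toLp 2 _).comp (measurable_pi_iff.2 fun q => ?_)
  exact Finset.measurable_sum _ fun κ _ =>
    ((measurable_pi_apply _).comp measurable_snd).mul ((hB _ _).comp measurable_fst)

theorem blockMap_sub {m : ℕ} {ι S : Type*} [Fintype ι] (B B' : Matrix ι S ℝ)
    (w : Fin m × ι → ℝ) : blockMap B w - blockMap B' w = blockMap (B - B') w := by
  ext q
  simp [blockMap, mul_sub]

theorem LipschitzWith.sum_sq_activationMatrix_sub_le {κ : ℝ≥0} (hσ : LipschitzWith κ σ)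
    (A B : EuclideanSpace ℝ (Fin n × S₀)) :
    ∑ q, ∑ s, (activationMatrix σ A - activationMatrix σ B) q s ^ 2 ≤ (κ * ‖A - B‖) ^ 2 := by
  have e : ∑ q, ∑ s, (activationMatrix σ A - activationMatrix σ B) q s ^ 2 =
      ∑ j, ‖σ (row A j) - σ (row B j)‖ ^ 2 := by
    simp [activationMatrix, EuclideanSpace.norm_sq_eq, Fintype.sum_prod_type]
  rw [e, mul_pow, ← sum_norm_row_sq, Finset.mul_sum]
  refine Finset.sum_le_sum fun j _ => ?_
  rw [← mul_pow, ← row_sub]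
  exact pow_le_pow_left₀ (norm_nonneg _) (hσ.norm_sub_le _ _) 2

/-- The layer map is a contraction, up to a constant, for the Wasserstein distances. -/
theorem LipschitzWith.exists_wasserstein_layerLaw_le {κ : ℝ≥0} (hσ : LipschitzWith κ σ) {k : ℕ}
    (hk : k ≠ 0) :
    ∃ c : ℝ, 0 ≤ c ∧ ∀ (n n' : ℕ) (ν₁ ν₂ : Measure (EuclideanSpace ℝ (Fin n × S₀)))
      [IsProbabilityMeasure ν₁] (B : ℝ), 0 ≤ B →
      wasserstein (2 * k : ℕ) ν₁ ν₂ ≤ ENNReal.ofReal B →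
      wasserstein (2 * k : ℕ) (layerLaw σ n' ν₁) (layerLaw σ n' ν₂) ≤
        ENNReal.ofReal (c * (√(n' : ℝ) / √(n : ℝ)) * B) := by
  obtain ⟨c, hc, hblock⟩ := exists_eLpNorm_blockMap_le k hk
  refine ⟨c * κ, by positivity, fun n n' ν₁ ν₂ _ B hB hle => ?_⟩
  -- The slack `ε` provides a coupling even if the infimum is not attained or `B = 0`. Both inputs
  -- are then fed the same weights, and `ε` tends to `0` at the end.
  have hstep : ∀ ε > 0, wasserstein (2 * k : ℕ) (layerLaw σ n' ν₁) (layerLaw σ n' ν₂) ≤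
      ENNReal.ofReal (c * κ * (√(n' : ℝ) / √(n : ℝ)) * (B + ε)) := fun ε hε => by
    obtain ⟨π, _, h₁, h₂, h₃⟩ := exists_coupling_lt
      (hle.trans_lt ((ENNReal.ofReal_lt_ofReal_iff (by positivity)).2 (lt_add_of_pos_right B hε)))
    rw [ENNReal.ofReal_natCast] at h₃
    set γ := gaussianArray n' (Fin n × Fin m) (n : ℝ≥0)⁻¹
    have hmeas := measurable_layerMap (n := n) (n' := n') hσ.continuous
    have e₁ : (π.prod γ).map (fun z => layerMap σ (z.1.1, z.2)) = layerLaw σ n' ν₁ := by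
      rw [← h₁, Measure.fst, layerLaw_map hσ.continuous π measurable_fst]
    have e₂ : (π.prod γ).map (fun z => layerMap σ (z.1.2, z.2)) = layerLaw σ n' ν₂ := by
      rw [← h₂, Measure.snd, layerLaw_map hσ.continuous π measurable_snd]
    have m₁ : Measurable fun z : (EuclideanSpace ℝ (Fin n × S₀) × EuclideanSpace ℝ (Fin n × S₀)) ×
        (Fin n' × (Fin n × Fin m) → ℝ) => layerMap (n' := n') σ (z.1.1, z.2) :=
      hmeas.comp ((measurable_fst.comp measurable_fst).prodMk measurable_snd)
    have m₂ : Measurable fun z : (EuclideanSpace ℝ (Fin n × S₀) × EuclideanSpace ℝ (Fin n × S₀)) ×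
        (Fin n' × (Fin n × Fin m) → ℝ) => layerMap (n' := n') σ (z.1.2, z.2) :=
      hmeas.comp ((measurable_snd.comp measurable_fst).prodMk measurable_snd)
    rw [← e₁, ← e₂]
    refine (wasserstein_map_le _ _ m₁.aemeasurable m₂.aemeasurable).trans ?_
    rw [ENNReal.ofReal_natCast]
    set C : ℝ := c * κ * (√(n' : ℝ) / √(n : ℝ)) with hC
    have hC0 : 0 ≤ C := by positivity
    have hpt : ∀ z : EuclideanSpace ℝ (Fin n × S₀) × EuclideanSpace ℝ (Fin n × S₀),
        eLpNorm (fun w => layerMap (n' := n') σ (z.1, w) - layerMap σ (z.2, w)) (2 * k : ℕ) γ ≤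
          C.toNNReal * ‖z.1 - z.2‖ₑ := fun z => by
      have e : (fun w => layerMap (n' := n') σ (z.1, w) - layerMap σ (z.2, w)) =
          blockMap (activationMatrix σ z.1 - activationMatrix σ z.2) :=
        funext fun w => blockMap_sub _ _ _
      rw [e]
      refine (hblock _ _ _).trans ?_
      rw [← ofReal_norm]
      change _ ≤ ENNReal.ofReal C * _
      rw [← ENNReal.ofReal_mul hC0]
      refine ENNReal.ofReal_le_ofReal ?_
      have e : C * ‖z.1 - z.2‖ = c * √(n' * ((n : ℝ)⁻¹ * (κ * ‖z.1 - z.2‖) ^ 2)) := by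
        rw [Real.sqrt_mul (by positivity), Real.sqrt_mul (by positivity), Real.sqrt_inv,
          Real.sqrt_sq (by positivity), hC]
        ring
      rw [e]
      gcongr
      · exact le_of_eq (by simp)
      · exact hσ.sum_sq_activationMatrix_sub_le z.1 z.2
    refine (eLpNorm_prod_le_of_forall_le (C := C.toNNReal) (g := fun z => z.1 - z.2)
      (by simpa using hk) (ENNReal.natCast_ne_top _) (m₁.sub m₂).aestronglyMeasurable
      (ae_of_all _ hpt)).trans ?_
    rw [ENNReal.ofReal_mul hC0]
    exact mul_le_mul_right h₃.le _
  have hlim : Filter.Tendsto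
      (fun ε : ℝ => ENNReal.ofReal (c * κ * (√(n' : ℝ) / √(n : ℝ)) * (B + ε)))
      (nhdsWithin 0 (Set.Ioi 0)) (nhds (ENNReal.ofReal (c * κ * (√(n' : ℝ) / √(n : ℝ)) * B))) := by
    have : Continuous fun ε : ℝ => ENNReal.ofReal (c * κ * (√(n' : ℝ) / √(n : ℝ)) * (B + ε)) :=
      ENNReal.continuous_ofReal.comp (by fun_prop)
    simpa using (this.tendsto 0).mono_left nhdsWithin_le_nhds
  exact ge_of_tendsto hlim (eventually_nhdsWithin_of_forall hstep)

/-- Equal conditional laws give equal laws. Almost everywhere is all that is available, because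
whitening reproduces the activations only almost surely. -/
theorem map_prod_congr_of_ae {A B B' E : Type*} [MeasurableSpace A] [MeasurableSpace B]
    [MeasurableSpace B'] [MeasurableSpace E] {π : Measure A} {γ : Measure B} {γ' : Measure B'}
    [SFinite π] [SFinite γ] [SFinite γ'] {f : A × B → E} {f' : A × B' → E} (hf : Measurable f)
    (hf' : Measurable f')
    (h : ∀ᵐ z ∂π, γ.map (fun w => f (z, w)) = γ'.map (fun w => f' (z, w))) :
    (π.prod γ).map f = (π.prod γ').map f' := by
  ext s hs
  rw [Measure.map_apply hf hs, Measure.map_apply hf' hs, Measure.prod_apply (hf hs),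
    Measure.prod_apply (hf' hs)]
  refine lintegral_congr_ae ?_
  filter_upwards [h] with z hz
  have := congrArg (fun ρ => ρ s) hz
  rwa [Measure.map_apply (by fun_prop) hs, Measure.map_apply (by fun_prop) hs] at this

/-- Whitening of the activations: their second moment is `R Rᵀ`, and almost surely their tensor
squares are `R Φ Rᵀ` with a positive semidefinite `Φ` of mean the identity matrix. -/
theorem LipschitzWith.exists_whitening [DecidableEq S₁] {κ : ℝ≥0}
    (hσ : LipschitzWith κ σ) {μ : Measure (EuclideanSpace ℝ S₀)} [IsProbabilityMeasure μ]
    (hμ : MemLp (fun z => z) 2 μ) :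
    ∃ (R : Matrix S₁ S₁ ℝ) (Φ : EuclideanSpace ℝ S₀ → Matrix S₁ S₁ ℝ)
      (φ : EuclideanSpace ℝ S₀ → EuclideanSpace ℝ (S₁ × S₁)),
      R * Rᵀ = tracedSecondMoment σ μ ∧ Continuous Φ ∧ (∀ z, (Φ z).PosSemidef) ∧
      (∀ z s t, φ z (s, t) = Φ z s t) ∧ Continuous φ ∧ QuadraticGrowth φ ∧
      (∀ s t, (∫ z, φ z ∂μ) (s, t) = (1 : Matrix S₁ S₁ ℝ) s t) ∧
      ∀ᵐ z ∂μ, R * Φ z * Rᵀ =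
        ∑ α, vecMulVec (fun s => σ z (α, s)) (fun s => σ z (α, s)) := by
  have hσc := hσ.continuous
  set K := tracedSecondMoment σ μ with hKdef
  have hK : K.PosSemidef := posSemidef_tracedSecondMoment hσ hμ
  obtain ⟨R, Q, hRR, hRQR, hQR⟩ := hK.exists_mul_transpose_pseudoinverse
  have hQRQR : Q * R * (Q * R) = Q * R := by
    rw [Matrix.mul_assoc, ← Matrix.mul_assoc R, hRQR]
  let Z : Fin m → EuclideanSpace ℝ S₀ → S₁ → ℝ := fun α z s => σ z (α, s)
  have hZc : ∀ α, Continuous (Z α) := fun α => by fun_prop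
  -- The whitened tensor squares have mean `Q * R`, a projection. The added complement `1 - Q * R`
  -- completes the mean to `1`, and is invisible after multiplication by `R` because `R * Q * R =
  -- R`.
  let Φ : EuclideanSpace ℝ S₀ → Matrix S₁ S₁ ℝ := fun z =>
    ∑ α, vecMulVec (Q *ᵥ Z α z) (Q *ᵥ Z α z) + (1 - Q * R)
  have hΦc : Continuous Φ := by
    have : ∀ α, Continuous fun z => Q *ᵥ Z α z := fun α =>
      continuous_const.matrix_mulVec (hZc α)
    exact (continuous_finsetSum _ fun α _ => (this α).matrix_vecMulVec (this α)).add
      continuous_const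
  have hΦp : ∀ z, (Φ z).PosSemidef := fun z => by
    refine (Matrix.posSemidef_sum _ fun α _ => ?_).add ?_
    · simpa using Matrix.posSemidef_vecMulVec_self_star (Q *ᵥ Z α z)
    · have : (1 - Q * R)ᴴ * (1 - Q * R) = 1 - Q * R := by
        rw [conjTranspose_eq_transpose_of_trivial, transpose_sub, transpose_one, hQR,
          Matrix.mul_sub, Matrix.sub_mul, Matrix.sub_mul, hQRQR]
        simp
      rw [← this]
      exact Matrix.posSemidef_conjTranspose_mul_self _
  let φ : EuclideanSpace ℝ S₀ → EuclideanSpace ℝ (S₁ × S₁) := fun z =>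
    WithLp.toLp 2 fun q => Φ z q.1 q.2
  have hφc : Continuous φ := by
    have : ∀ s t, Continuous fun z => Φ z s t := fun s t => hΦc.matrix_elem s t
    fun_prop
  have hQZ : ∀ α s z, |∑ t, Q s t * σ z (α, t)| ≤ ((∑ t, |Q s t|) * (‖σ 0‖ + κ)) * (1 + ‖z‖) :=
    fun α s z => hσ.abs_sum_mul_apply_le (Q s) α z
  have hφapp : ∀ z s t, φ z (s, t) =
      ∑ α, (∑ u, Q s u * σ z (α, u)) * (∑ u, Q t u * σ z (α, u)) + (1 - Q * R) s t :=
    fun z s t => by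
      simp only [φ, Φ, Matrix.add_apply, Matrix.sum_apply, vecMulVec_apply]
      rfl
  have hterm : ∀ α s t, QuadraticGrowth fun z : EuclideanSpace ℝ S₀ =>
      (∑ u, Q s u * σ z (α, u)) * (∑ u, Q t u * σ z (α, u)) := fun α s t =>
    QuadraticGrowth.mul (hQZ α s) (hQZ α t)
  have hφg : QuadraticGrowth φ := quadraticGrowth_euclidean fun ⟨s, t⟩ => by
    simp only [hφapp]
    exact (QuadraticGrowth.sum _ fun α _ => hterm α s t).add (quadraticGrowth_const _)
  have hφi : Integrable φ μ := hφg.integrable hμ hφc.aestronglyMeasurable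
  have hmean : ∀ s t, (∫ z, φ z ∂μ) (s, t) = (1 : Matrix S₁ S₁ ℝ) s t := fun s t => by
    have e : (∫ z, φ z ∂μ) (s, t) = ∫ z, φ z (s, t) ∂μ :=
      ((EuclideanSpace.proj (𝕜 := ℝ) (s, t)).integral_comp_comm hφi).symm
    have hi : ∀ α, Integrable (fun z : EuclideanSpace ℝ S₀ =>
        (∑ u, Q s u * σ z (α, u)) * (∑ u, Q t u * σ z (α, u))) μ := fun α =>
      (hterm α s t).integrable hμ (Continuous.aestronglyMeasurable (by fun_prop))
    rw [e]
    simp only [hφapp]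
    rw [integral_add (integrable_finsetSum _ fun α _ => hi α) (integrable_const _),
      integral_finsetSum _ fun α _ => hi α, integral_const,
      ← sum_mul_sum_tracedSecondMoment hσ hμ]
    have e2 : ∑ u, ∑ v, Q s u * Q t v * tracedSecondMoment σ μ u v = (Q * K * Qᵀ) s t := by
      simp only [Matrix.mul_apply, Finset.sum_mul, Matrix.transpose_apply]
      rw [Finset.sum_comm]
      exact Finset.sum_congr rfl fun v _ => Finset.sum_congr rfl fun u _ => by ring
    have e3 : Q * K * Qᵀ = Q * R := by
      calc Q * K * Qᵀ = (Q * R) * (Q * R)ᵀ := by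
            rw [← hRR, transpose_mul]; simp only [Matrix.mul_assoc]
        _ = _ := by rw [hQR, hQRQR]
    rw [e2, e3]
    simp
  refine ⟨R, Φ, φ, hRR, hΦc, hΦp, fun _ _ _ => rfl, hφc, hφg, hmean, ?_⟩
  have hP : R * Q * K = K := by
    rw [← hRR, ← Matrix.mul_assoc, hRQR]
  filter_upwards [ae_mulVec_eq_of_mul_tracedSecondMoment_eq hσ hμ hP] with z hz
  have hz' : ∀ α, (R * Q) *ᵥ Z α z = Z α z := hz
  simp only [Φ, Matrix.mul_add, Matrix.mul_sum, Matrix.sum_mul,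
    Matrix.mul_sub, ← Matrix.mul_assoc, hRQR, Matrix.mul_one, sub_self,
    add_zero, mul_vecMulVec, vecMulVec_mul, vecMul_transpose, mulVec_mulVec, hz']
  rfl

/-- Comparison of the layer following `n` independent neurons of law `μ` with its infinite-width
limit, in terms of the fluctuations of an empirical average. -/
theorem LipschitzWith.exists_wasserstein_layerLaw_copies_le [DecidableEq S₁] {κ : ℝ≥0}
    (hσ : LipschitzWith κ σ) {μ : Measure (EuclideanSpace ℝ S₀)} [IsProbabilityMeasure μ]
    (hμ : MemLp (fun z => z) 2 μ) {k : ℕ} (hk : k ≠ 0) :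
    ∃ (c : ℝ) (φ : EuclideanSpace ℝ S₀ → EuclideanSpace ℝ (S₁ × S₁)), 0 ≤ c ∧ Continuous φ ∧
      QuadraticGrowth φ ∧ ∀ n n' : ℕ, 0 < n →
      wasserstein (2 * k : ℕ)
          (layerLaw σ n' ((Measure.pi fun _ : Fin n => μ).map stackRows))
          ((Measure.pi fun _ : Fin n' =>
            multivariateGaussian 0 (tracedSecondMoment σ μ)).map stackRows) ≤
        ENNReal.ofReal (c * √(n' : ℝ)) *
          eLpNorm (fun g : Fin n → EuclideanSpace ℝ S₀ => (n : ℝ)⁻¹ • ∑ i, φ (g i) - ∫ z, φ z ∂μ)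
            (2 * k : ℕ) (Measure.pi fun _ : Fin n => μ) := by
  obtain ⟨c, hc, hblock⟩ := exists_eLpNorm_blockMap_le k hk
  obtain ⟨R, Φ, φ, hRR, hΦc, hΦp, hφΦ, hφc, hφg, hmean, hae⟩ := hσ.exists_whitening hμ
  set r : ℝ := √(∑ s, ∑ t, Rᵀ s t ^ 2) with hr
  refine ⟨c * r, φ, by positivity, hφc, hφg, fun n n' hn => ?_⟩
  have hn0 : (n : ℝ) ≠ 0 := by exact_mod_cast hn.ne'
  -- The whitened empirical covariance: an i.i.d. average with mean `1`.
  let M : (Fin n → EuclideanSpace ℝ S₀) → Matrix S₁ S₁ ℝ := fun g => (n : ℝ)⁻¹ • ∑ j, Φ (g j)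
  have hMc : Continuous M := by fun_prop
  have hMp : ∀ g, (M g).PosSemidef := fun g =>
    (Matrix.posSemidef_sum _ fun j _ => hΦp (g j)).smul (by positivity)
  obtain ⟨N, hNc, hNp, hNN⟩ := exists_continuous_posSemidef_sqrt hMc hMp
  set π := Measure.pi fun _ : Fin n => μ
  set γ := gaussianArray n' S₁ 1
  have mF : Measurable fun z : (Fin n → EuclideanSpace ℝ S₀) × (Fin n' × S₁ → ℝ) =>
      blockMap (m := n') (N z.1 * Rᵀ) z.2 := by
    have : Continuous fun g => N g * Rᵀ := hNc.matrix_mul continuous_const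
    exact measurable_blockMap_prod fun κ s => (this.matrix_elem κ s).measurable
  have mG : Measurable fun z : (Fin n → EuclideanSpace ℝ S₀) × (Fin n' × S₁ → ℝ) =>
      blockMap (m := n') Rᵀ z.2 := (measurable_blockMap _).comp measurable_snd
  have hlaw₁ : layerLaw σ n' (π.map stackRows) =
      (π.prod γ).map fun z => blockMap (m := n') (N z.1 * Rᵀ) z.2 := by
    rw [layerLaw_map hσ.continuous π measurable_stackRows]
    refine map_prod_congr_of_ae ((measurable_layerMap hσ.continuous).comp
      ((measurable_stackRows.comp measurable_fst).prodMk measurable_snd)) mF ?_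
    have hall : ∀ᵐ g ∂π, ∀ j, R * Φ (g j) * Rᵀ =
        ∑ α, vecMulVec (fun s => σ (g j) (α, s)) (fun s => σ (g j) (α, s)) :=
      ae_all_iff.2 fun j =>
        (measurePreserving_eval (fun _ : Fin n => μ) j).quasiMeasurePreserving.ae hae
    filter_upwards [hall] with g hg
    change (gaussianArray n' (Fin n × Fin m) (n : ℝ≥0)⁻¹).map
      (blockMap (activationMatrix σ (stackRows g))) = γ.map (blockMap (N g * Rᵀ))
    refine map_blockMap_congr fun s t => ?_
    have hRMR : R * M g * Rᵀ =
        (n : ℝ)⁻¹ • ∑ j, ∑ α, vecMulVec (fun s => σ (g j) (α, s)) (fun s => σ (g j) (α, s)) := by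
      simp only [M, Matrix.mul_smul, Matrix.smul_mul, Matrix.mul_sum, Matrix.sum_mul, hg]
    have hsq : ∑ κ, (N g * Rᵀ) κ s * (N g * Rᵀ) κ t = (R * M g * Rᵀ) s t := by
      have hNt : (N g)ᵀ = N g := by
        have := (hNp g).1
        rwa [Matrix.IsHermitian, conjTranspose_eq_transpose_of_trivial] at this
      have : R * M g * Rᵀ = (N g * Rᵀ)ᵀ * (N g * Rᵀ) := by
        rw [transpose_mul, hNt, transpose_transpose, ← hNN]
        simp only [Matrix.mul_assoc]
      rw [this, Matrix.mul_apply]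
      rfl
    rw [hsq, hRMR]
    simp [activationMatrix, Matrix.sum_apply, vecMulVec_apply, Fintype.sum_prod_type,
      row_stackRows]
  have hlaw₂ : (Measure.pi fun _ : Fin n' => multivariateGaussian 0 (tracedSecondMoment σ μ)).map stackRows =
      (π.prod γ).map fun z => blockMap (m := n') Rᵀ z.2 := by
    have h1 : (π.prod γ).map (fun z => blockMap (m := n') Rᵀ z.2) = γ.map (blockMap Rᵀ) := by
      have h2 : ((π.prod γ).map Prod.snd).map (blockMap (m := n') Rᵀ) =
          (π.prod γ).map (fun z => blockMap (m := n') Rᵀ z.2) :=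
        Measure.map_map (measurable_blockMap _) measurable_snd
      rw [← h2, Measure.map_snd_prod]
      simp
    rw [h1]
    refine map_pi_multivariateGaussian (posSemidef_tracedSecondMoment hσ hμ) fun s t => ?_
    rw [← hRR, Matrix.mul_apply]
    rfl
  -- Both laws are now images of `π.prod γ`; sharing the Gaussian array is the coupling.
  rw [hlaw₁, hlaw₂]
  refine (wasserstein_map_le _ _ mF.aemeasurable mG.aemeasurable).trans ?_
  rw [ENNReal.ofReal_natCast]
  refine eLpNorm_prod_le_of_forall_le (C := (c * r * √(n' : ℝ)).toNNReal) (by simpa using hk)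
    (ENNReal.natCast_ne_top _) (mF.sub mG).aestronglyMeasurable (ae_of_all _ fun g => ?_)
  simp only [blockMap_sub]
  refine (hblock _ _ _).trans ?_
  rw [← ofReal_norm]
  change _ ≤ ENNReal.ofReal _ * _
  rw [← ENNReal.ofReal_mul (by positivity)]
  refine ENNReal.ofReal_le_ofReal ?_
  have hfrob : ∑ s, ∑ t, (N g * Rᵀ - Rᵀ) s t ^ 2 ≤
      (∑ s, ∑ t, (M g - 1) s t ^ 2) * ∑ s, ∑ t, Rᵀ s t ^ 2 := by
    have : N g * Rᵀ - Rᵀ = (N g - 1) * Rᵀ := by rw [Matrix.sub_mul, Matrix.one_mul]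
    rw [this]
    refine (sum_sq_mul_le _ _).trans ?_
    refine mul_le_mul_of_nonneg_right ?_ (by positivity)
    rw [← hNN]
    exact sum_sq_sqrt_sub_one_le (hNp g)
  have hnorm : ‖(n : ℝ)⁻¹ • ∑ i, φ (g i) - ∫ z, φ z ∂μ‖ = √(∑ s, ∑ t, (M g - 1) s t ^ 2) := by
    rw [EuclideanSpace.norm_eq, Fintype.sum_prod_type]
    congr 1
    refine Finset.sum_congr rfl fun s _ => Finset.sum_congr rfl fun t _ => ?_
    rw [Real.norm_eq_abs, sq_abs, PiLp.sub_apply, hmean]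
    congr 1
    simp [M, hφΦ, Matrix.sum_apply]
  rw [hnorm]
  calc c * √(n' * ((1 : ℝ≥0) * ∑ s, ∑ t, (N g * Rᵀ - Rᵀ) s t ^ 2))
      ≤ c * √(n' * ((∑ s, ∑ t, (M g - 1) s t ^ 2) * ∑ s, ∑ t, Rᵀ s t ^ 2)) := by
        rw [NNReal.coe_one, one_mul]
        gcongr
    _ = _ := by
        rw [Real.sqrt_mul (by positivity), Real.sqrt_mul (by positivity), hr]
        ring

end Layer

/-! ### The law of the network as a recursion -/

section NetworkLaw

variable {S : ℕ → Type*} {a : ℕ → ℕ}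
  (σ : ∀ ℓ, EuclideanSpace ℝ (S ℓ) → EuclideanSpace ℝ (Fin (a (ℓ + 1)) × S (ℓ + 1)))
  (x : EuclideanSpace ℝ (S 0))

theorem network_congr (n : ℕ → ℕ) (ℓ : ℕ)
    {w w' : ∀ ℓ, Fin (n (ℓ + 1)) → Fin (n ℓ) → Fin (a (ℓ + 1)) → ℝ}
    (h : ∀ m < ℓ, w m = w' m) : network σ x n w ℓ = network σ x n w' ℓ := by
  induction ℓ with
  | zero => rfl
  | succ ℓ ih => rw [network, network, ih fun m hm => h m (by omega), h ℓ (by omega)]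

theorem network_succ_eq_layerMap (n : ℕ → ℕ)
    (w : ∀ ℓ, Fin (n (ℓ + 1)) → Fin (n ℓ) → Fin (a (ℓ + 1)) → ℝ) (ℓ : ℕ) :
    network σ x n w (ℓ + 1) =
      layerMap (σ ℓ) (network σ x n w ℓ, fun q => w ℓ q.1 q.2.1 q.2.2) := by
  simp [network, layerMap, blockMap, activationMatrix, Fintype.sum_prod_type]

variable [∀ ℓ, Fintype (S ℓ)]

theorem measurable_network (n : ℕ → ℕ) (ℓ : ℕ) (hσ : ∀ m < ℓ, Continuous (σ m))
    {X : Type*} [MeasurableSpace X]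
    {w : X → ∀ ℓ, Fin (n (ℓ + 1)) → Fin (n ℓ) → Fin (a (ℓ + 1)) → ℝ}
    (hw : ∀ m < ℓ, ∀ i j α, Measurable fun v => w v m i j α) :
    Measurable fun v => network σ x n (w v) ℓ := by
  induction ℓ with
  | zero => exact measurable_const
  | succ ℓ ih =>
    simp only [network_succ_eq_layerMap]
    refine (measurable_layerMap (hσ ℓ (by omega))).comp (Measurable.prodMk
      (ih (fun m hm => hσ m (by omega)) fun m hm => hw m (by omega)) (measurable_pi_iff.2 fun q => ?_))
    exact hw ℓ (by omega) _ _ _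

/-- The law of the layers of the network. -/
noncomputable def networkLaw (n : ℕ → ℕ) : ∀ ℓ, Measure (EuclideanSpace ℝ (Fin (n ℓ) × S ℓ))
  | 0 => Measure.dirac (WithLp.toLp 2 fun q => x q.2)
  | ℓ + 1 => layerLaw (σ ℓ) (n (ℓ + 1)) (networkLaw n ℓ)

theorem isProbabilityMeasure_networkLaw (n : ℕ → ℕ) (ℓ : ℕ) (hσ : ∀ m < ℓ, Continuous (σ m)) :
    IsProbabilityMeasure (networkLaw σ x n ℓ) := by
  induction ℓ with
  | zero => exact Measure.dirac.isProbabilityMeasure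
  | succ ℓ ih =>
    have := ih fun m hm => hσ m (by omega)
    exact isProbabilityMeasure_layerLaw (hσ ℓ (by omega)) _

variable {σ x}

theorem exists_network_eq_comp {Ω : Type*} {L : ℕ} {n : ℕ → ℕ}
    (W : ∀ ℓ, Fin (n (ℓ + 1)) → Fin (n ℓ) → Fin (a (ℓ + 1)) → Ω → ℝ) {ℓ : ℕ} (hℓ : ℓ ≤ L) (hσ : ∀ m < ℓ, Continuous (σ m)) :
    ∃ F : ((q : {q : Σ ℓ : Fin L, Fin (n (ℓ + 1)) × Fin (n ℓ) × Fin (a (ℓ + 1)) //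
          q ∈ Finset.univ.filter fun q => (q.1 : ℕ) < ℓ}) → ℝ) →
        EuclideanSpace ℝ (Fin (n ℓ) × S ℓ), Measurable F ∧
      (fun ω => network σ x n (fun m i j α => W m i j α ω) ℓ) =
        F ∘ fun ω q => W q.1.1 q.1.2.1 q.1.2.2.1 q.1.2.2.2 ω := by
  -- Weights from layer `ℓ` on are set to `0`; by `network_congr` they do not matter.
  refine ⟨fun v => network σ x n (fun m i j α => if h : m < ℓ then
    v ⟨⟨⟨m, h.trans_le hℓ⟩, (i, j, α)⟩, by simpa using h⟩ else 0) ℓ, ?_, ?_⟩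
  · refine measurable_network σ x n ℓ hσ fun m hm i j α => ?_
    simp only [hm, dite_true]
    exact measurable_pi_apply _
  · funext ω
    refine network_congr σ x n ℓ fun m hm => ?_
    funext i j α
    simp [hm]

variable {Ω : Type*} [MeasurableSpace Ω] {P : Measure Ω} {L : ℕ} {n : ℕ → ℕ}
  {W : ∀ ℓ, Fin (n (ℓ + 1)) → Fin (n ℓ) → Fin (a (ℓ + 1)) → Ω → ℝ}

theorem IsGaussianWeights.aemeasurable (hW : IsGaussianWeights P L n a W)
    (q : Σ ℓ : Fin L, Fin (n (ℓ + 1)) × Fin (n ℓ) × Fin (a (ℓ + 1))) :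
    AEMeasurable (W q.1 q.2.1 q.2.2.1 q.2.2.2) P :=
  (hW.hasLaw q.1 q.1.2 _ _ _).aemeasurable

theorem IsGaussianWeights.map_layer [IsProbabilityMeasure P] (hW : IsGaussianWeights P L n a W)
    {ℓ : ℕ} (hℓ : ℓ < L) :
    P.map (fun ω (q : Fin (n (ℓ + 1)) × Fin (n ℓ) × Fin (a (ℓ + 1))) => W ℓ q.1 q.2.1 q.2.2 ω) =
      gaussianArray (n (ℓ + 1)) (Fin (n ℓ) × Fin (a (ℓ + 1))) (n ℓ : ℝ≥0)⁻¹ := by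
  let e : Fin (n (ℓ + 1)) × Fin (n ℓ) × Fin (a (ℓ + 1)) →
      Σ ℓ : Fin L, Fin (n (ℓ + 1)) × Fin (n ℓ) × Fin (a (ℓ + 1)) := fun q => ⟨⟨ℓ, hℓ⟩, q⟩
  have he : Function.Injective e := fun q q' h => by simpa [e] using h
  have h := (hW.indep.precomp he).map_fun_eq_pi_map fun q => hW.aemeasurable (e q)
  refine h.trans ?_
  rw [gaussianArray]
  congr 1
  funext q
  exact (hW.hasLaw ℓ hℓ q.1 q.2.1 q.2.2).map_eq

/-- Layer `ℓ` is a function of the weights of index below `ℓ`, hence independent of those of index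
`ℓ`; their joint law is the product used by `layerLaw`. -/
theorem IsGaussianWeights.map_network [IsProbabilityMeasure P]
    (hW : IsGaussianWeights P L n a W) (hσ : ∀ m < L, Continuous (σ m)) {ℓ : ℕ} (hℓ : ℓ ≤ L) :
    P.map (fun ω => network σ x n (fun m i j α => W m i j α ω) ℓ) = networkLaw σ x n ℓ := by
  induction ℓ with
  | zero => simp [network, networkLaw, Measure.map_const]
  | succ ℓ ih =>
    have hℓ' : ℓ < L := hℓ
    let lo := Finset.univ.filter fun q : Σ ℓ : Fin L,
      Fin (n (ℓ + 1)) × Fin (n ℓ) × Fin (a (ℓ + 1)) => (q.1 : ℕ) < ℓ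
    let hi := Finset.univ.filter fun q : Σ ℓ : Fin L,
      Fin (n (ℓ + 1)) × Fin (n ℓ) × Fin (a (ℓ + 1)) => (q.1 : ℕ) = ℓ
    have hdisj : Disjoint lo hi := Finset.disjoint_filter.2 fun q _ h h' => by omega
    obtain ⟨F, hF, hFe⟩ := exists_network_eq_comp (σ := σ) (x := x) W hℓ'.le
      fun m hm => hσ m (by omega)
    let G : (hi → ℝ) → Fin (n (ℓ + 1)) × Fin (n ℓ) × Fin (a (ℓ + 1)) → ℝ := fun v q =>
      v ⟨⟨⟨ℓ, hℓ'⟩, q⟩, by simp [hi]⟩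
    have hG : Measurable G := measurable_pi_iff.2 fun q => measurable_pi_apply _
    have hind := (hW.indep.indepFun_finset₀ lo hi hdisj hW.aemeasurable).comp hF hG
    have hGe : (fun ω (q : Fin (n (ℓ + 1)) × Fin (n ℓ) × Fin (a (ℓ + 1))) =>
        W ℓ q.1 q.2.1 q.2.2 ω) = G ∘ fun ω q => W q.1.1 q.1.2.1 q.1.2.2.1 q.1.2.2.2 ω := rfl
    rw [← hFe, ← hGe] at hind
    have mF : AEMeasurable (fun ω => network σ x n (fun m i j α => W m i j α ω) ℓ) P := by
      rw [hFe]
      exact hF.comp_aemeasurable (aemeasurable_pi_iff.2 fun q => hW.aemeasurable q)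
    have mG : AEMeasurable (fun ω (q : Fin (n (ℓ + 1)) × Fin (n ℓ) × Fin (a (ℓ + 1))) =>
        W ℓ q.1 q.2.1 q.2.2 ω) P := by
      rw [hGe]
      exact hG.comp_aemeasurable (aemeasurable_pi_iff.2 fun q => hW.aemeasurable q)
    have hprod := (indepFun_iff_map_prod_eq_prod_map_map mF mG).1 hind
    rw [ih hℓ'.le, hW.map_layer hℓ'] at hprod
    rw [networkLaw, layerLaw, ← hprod, AEMeasurable.map_map_of_aemeasurable
      (measurable_layerMap (hσ ℓ hℓ')).aemeasurable (mF.prodMk mG)]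
    congr 1
    funext ω
    exact network_succ_eq_layerMap σ x n _ ℓ

end NetworkLaw

/-! ### The Gaussian limit and its copies -/

section LimitLaw

variable {S : ℕ → Type*} {a : ℕ → ℕ}
  {σ : ∀ ℓ, EuclideanSpace ℝ (S ℓ) → EuclideanSpace ℝ (Fin (a (ℓ + 1)) × S (ℓ + 1))}
  {x : EuclideanSpace ℝ (S 0)} [∀ ℓ, Fintype (S ℓ)] [∀ ℓ, DecidableEq (S ℓ)]

instance isProbabilityMeasure_limitLaw (ℓ : ℕ) : IsProbabilityMeasure (limitLaw σ x ℓ) := by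
  cases ℓ with
  | zero => exact Measure.dirac.isProbabilityMeasure
  | succ ℓ => rw [limitLaw]; infer_instance

theorem memLp_limitLaw (ℓ q : ℕ) : MemLp (fun z => z) q (limitLaw σ x ℓ) := by
  cases ℓ with
  | zero =>
    rw [limitLaw]
    exact (memLp_const x).ae_eq (ae_eq_dirac (fun z : EuclideanSpace ℝ (S 0) => z)).symm
  | succ ℓ =>
    rw [limitLaw]
    exact IsGaussian.memLp_id _ _ (ENNReal.natCast_ne_top q)

theorem limitLawCopies_eq (n ℓ : ℕ) :
    limitLawCopies σ x n ℓ = (Measure.pi fun _ : Fin n => limitLaw σ x ℓ).map stackRows := rfl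

instance isProbabilityMeasure_limitLawCopies (n ℓ : ℕ) :
    IsProbabilityMeasure (limitLawCopies σ x n ℓ) := by
  rw [limitLawCopies_eq]
  exact Measure.isProbabilityMeasure_map measurable_stackRows.aemeasurable

theorem MeasureTheory.Measure.pi_dirac_const {ι E : Type*} [Fintype ι] [MeasurableSpace E] (z : E) :
    Measure.pi (fun _ : ι => Measure.dirac z) = Measure.dirac fun _ => z := by
  classical
  refine Measure.pi_eq fun s hs => ?_
  rw [Measure.dirac_apply' _ (MeasurableSet.univ_pi hs)]
  simp only [Measure.dirac_apply' _ (hs _), Set.indicator_apply, Set.mem_univ_pi, Pi.one_apply]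
  by_cases h : ∀ i, z ∈ s i
  · simp [h]
  · rw [if_neg h]
    push Not at h
    obtain ⟨i, hi⟩ := h
    exact (Finset.prod_eq_zero (Finset.mem_univ i) (by simp [hi])).symm

theorem limitLawCopies_zero (n : ℕ) :
    limitLawCopies σ x n 0 = Measure.dirac (WithLp.toLp 2 fun q => x q.2) := by
  rw [limitLawCopies_eq, limitLaw, Measure.pi_dirac_const, Measure.map_dirac' measurable_stackRows]
  rfl

end LimitLaw

/-! ### Tensor squares and the empirical kernel -/

section TensorSquares

theorem continuous_tensorSq {T : Type*} : Continuous (tensorSq : EuclideanSpace ℝ T → _) := by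
  unfold tensorSq
  fun_prop


theorem continuous_empiricalKernel {n : ℕ} {S T : Type*} [Fintype T] {h : EuclideanSpace ℝ S → EuclideanSpace ℝ T}
    (hh : Continuous h) : Continuous (empiricalKernel (n := n) h) := by
  unfold empiricalKernel
  have hi : ∀ i : Fin n, Continuous fun A => tensorSq (h (row A i)) := fun i =>
    continuous_tensorSq.comp (hh.comp (continuous_row i))
  fun_prop

variable {S T : Type*} [Fintype S] [Fintype T]

theorem norm_toLp_mul (u v : EuclideanSpace ℝ T) :
    ‖(WithLp.toLp 2 fun q : T × T => u q.1 * v q.2 : EuclideanSpace ℝ (T × T))‖ = ‖u‖ * ‖v‖ := by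
  rw [EuclideanSpace.norm_eq, EuclideanSpace.norm_eq, EuclideanSpace.norm_eq,
    ← Real.sqrt_mul (by positivity), Fintype.sum_prod_type, Finset.sum_mul_sum]
  simp only [norm_mul, mul_pow]

theorem norm_tensorSq (u : EuclideanSpace ℝ T) : ‖tensorSq u‖ = ‖u‖ ^ 2 :=
  (norm_toLp_mul u u).trans (sq _).symm

theorem norm_tensorSq_sub_le (u v : EuclideanSpace ℝ T) :
    ‖tensorSq u - tensorSq v‖ ≤ ‖u - v‖ * (‖u‖ + ‖v‖) := by
  have e : tensorSq u - tensorSq v =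
      (WithLp.toLp 2 fun q : T × T => u q.1 * (u - v) q.2 : EuclideanSpace ℝ (T × T)) +
        (WithLp.toLp 2 fun q : T × T => (u - v) q.1 * v q.2 : EuclideanSpace ℝ (T × T)) := by
    ext q
    simp [tensorSq]
    ring
  rw [e]
  refine (norm_add_le _ _).trans (le_of_eq ?_)
  rw [norm_toLp_mul, norm_toLp_mul]
  ring

/-- Cauchy–Schwarz over the rows. The bound involves `B` and `A - B` only, so moments of the network
itself are never needed when `B` is the Gaussian side. -/
theorem LipschitzWith.norm_empiricalKernel_sub_le {n : ℕ}
    {h : EuclideanSpace ℝ S → EuclideanSpace ℝ T} {κ : ℝ≥0} (hh : LipschitzWith κ h)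
    (A B : EuclideanSpace ℝ (Fin n × S)) :
    ‖empiricalKernel h A - empiricalKernel h B‖ ≤
      (‖h 0‖ + κ) ^ 2 * (n : ℝ)⁻¹ * (‖A - B‖ * (2 * √(n : ℝ) + 2 * ‖B‖ + ‖A - B‖)) := by
  set H := ‖h 0‖ + κ with hH
  have hH0 : 0 ≤ H := by positivity
  have hκ : (κ : ℝ) ≤ H := le_add_of_nonneg_left (norm_nonneg _)
  set d : Fin n → ℝ := fun i => ‖row (A - B) i‖
  have hdn : ∑ i, d i ^ 2 = ‖A - B‖ ^ 2 := sum_norm_row_sq _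
  have hBn : ∑ i, ‖row B i‖ ^ 2 = ‖B‖ ^ 2 := sum_norm_row_sq _
  have hterm : ∀ i, ‖tensorSq (h (row A i)) - tensorSq (h (row B i))‖ ≤
      H ^ 2 * (2 * (d i * 1) + 2 * (d i * ‖row B i‖) + d i ^ 2) := fun i => by
    have h1 : ‖h (row A i) - h (row B i)‖ ≤ H * d i :=
      (hh.norm_sub_le _ _).trans (mul_le_mul_of_nonneg_right hκ (norm_nonneg _))
    have h2 : ‖h (row B i)‖ ≤ H * (1 + ‖row B i‖) := hh.exists_norm_le _
    have h3 : ‖h (row A i)‖ ≤ ‖h (row B i)‖ + ‖h (row A i) - h (row B i)‖ :=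
      norm_le_norm_add_norm_sub' _ _
    have hd : 0 ≤ d i := norm_nonneg _
    calc _ ≤ ‖h (row A i) - h (row B i)‖ * (‖h (row A i)‖ + ‖h (row B i)‖) :=
          norm_tensorSq_sub_le _ _
      _ ≤ (H * d i) * (2 * (H * (1 + ‖row B i‖)) + H * d i) := by
          refine mul_le_mul h1 (by linarith) (by positivity) (by positivity)
      _ = _ := by ring
  have c1 : ∑ i, d i * 1 ≤ ‖A - B‖ * √(n : ℝ) := by
    have := Real.sum_mul_le_sqrt_mul_sqrt Finset.univ d fun _ => 1
    simpa [hdn] using this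
  have c2 : ∑ i, d i * ‖row B i‖ ≤ ‖A - B‖ * ‖B‖ := by
    have := Real.sum_mul_le_sqrt_mul_sqrt Finset.univ d fun i => ‖row B i‖
    simpa [hdn, hBn] using this
  have e : empiricalKernel h A - empiricalKernel h B =
      (n : ℝ)⁻¹ • ∑ i, (tensorSq (h (row A i)) - tensorSq (h (row B i))) := by
    rw [empiricalKernel, empiricalKernel, Finset.sum_sub_distrib, smul_sub]
  rw [e, norm_smul, Real.norm_of_nonneg (by positivity)]
  calc _ ≤ (n : ℝ)⁻¹ * ∑ i, H ^ 2 * (2 * (d i * 1) + 2 * (d i * ‖row B i‖) + d i ^ 2) := by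
        gcongr
        exact (norm_sum_le _ _).trans (Finset.sum_le_sum fun i _ => hterm i)
    _ = (n : ℝ)⁻¹ * (H ^ 2 *
          (2 * ∑ i, d i * 1 + 2 * ∑ i, d i * ‖row B i‖ + ∑ i, d i ^ 2)) := by
        simp only [← Finset.mul_sum, Finset.sum_add_distrib]
    _ ≤ (n : ℝ)⁻¹ * (H ^ 2 *
          (2 * (‖A - B‖ * √(n : ℝ)) + 2 * (‖A - B‖ * ‖B‖) + ‖A - B‖ ^ 2)) := by
        rw [hdn]
        gcongr
    _ = _ := by ring

theorem eLpNorm_mul_add_le {Ω : Type*} [MeasurableSpace Ω] {ρ : Measure Ω}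
    [IsProbabilityMeasure ρ] {q r : ℝ≥0∞} [ENNReal.HolderTriple q q r] (hq : 1 ≤ q) {u v : Ω → ℝ}
    (hu : AEStronglyMeasurable u ρ) (hv : AEStronglyMeasurable v ρ) {b β δ : ℝ} (hb : 0 ≤ b)
    (hβ : 0 ≤ β) (hδ : 0 ≤ δ) (hub : eLpNorm u q ρ ≤ ENNReal.ofReal δ)
    (hvb : eLpNorm v q ρ ≤ ENNReal.ofReal β) :
    eLpNorm (fun ω => u ω * (b + 2 * v ω + u ω)) r ρ ≤
      ENNReal.ofReal (δ * (b + 2 * β + δ)) := by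
  have hq0 : q ≠ 0 := (zero_lt_one.trans_le hq).ne'
  have m1 : AEStronglyMeasurable (fun ω => 2 * v ω) ρ := hv.const_mul 2
  have m2 : AEStronglyMeasurable (fun ω => b + 2 * v ω) ρ := aestronglyMeasurable_const.add m1
  have hfac : eLpNorm (fun ω => b + 2 * v ω + u ω) q ρ ≤ ENNReal.ofReal (b + 2 * β + δ) := by
    rw [ENNReal.ofReal_add (by positivity) hδ, ENNReal.ofReal_add hb (by positivity)]
    refine (eLpNorm_add_le m2 hu hq).trans (add_le_add ?_ hub)
    refine (eLpNorm_add_le aestronglyMeasurable_const m1 hq).trans (add_le_add ?_ ?_)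
    · rw [eLpNorm_const _ hq0 (NeZero.ne ρ)]
      simp [Real.enorm_eq_ofReal hb]
    · refine (le_of_eq (eLpNorm_const_smul (2 : ℝ) v q ρ)).trans ?_
      rw [ENNReal.ofReal_mul two_pos.le, Real.enorm_eq_ofReal two_pos.le]
      exact mul_le_mul_right hvb _
  refine (eLpNorm_smul_le_mul_eLpNorm (p := q) (q := q) (m2.add hu) hu).trans ?_
  rw [ENNReal.ofReal_mul hδ]
  exact mul_le_mul' hub hfac

theorem holderTriple_two_mul (k : ℕ) :
    ENNReal.HolderTriple (2 * (2 * k) : ℕ) (2 * (2 * k) : ℕ) (2 * k : ℕ) := by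
  constructor
  push_cast
  rw [ENNReal.mul_inv (by simp) (by simp), ← two_mul, ← mul_assoc,
    ENNReal.mul_inv_cancel (by simp) (by simp), one_mul]

theorem LipschitzWith.eLpNorm_empiricalKernel_sub_le {n : ℕ}
    {h : EuclideanSpace ℝ S → EuclideanSpace ℝ T} {κ : ℝ≥0} (hh : LipschitzWith κ h)
    {π : Measure (EuclideanSpace ℝ (Fin n × S) × EuclideanSpace ℝ (Fin n × S))}
    [IsProbabilityMeasure π] {k : ℕ} (hk : k ≠ 0) {β δ : ℝ} (hβ : 0 ≤ β) (hδ : 0 ≤ δ)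
    (hd : eLpNorm (fun z => z.1 - z.2) (2 * (2 * k) : ℕ) π ≤ ENNReal.ofReal δ)
    (hB : eLpNorm (fun z => z.2) (2 * (2 * k) : ℕ) π ≤ ENNReal.ofReal β) :
    eLpNorm (fun z => empiricalKernel h z.1 - empiricalKernel h z.2) (2 * k : ℕ) π ≤
      ENNReal.ofReal ((‖h 0‖ + κ) ^ 2 * (n : ℝ)⁻¹ * (δ * (2 * √(n : ℝ) + 2 * β + δ))) := by
  have := holderTriple_two_mul k
  have hq : (1 : ℝ≥0∞) ≤ (2 * (2 * k) : ℕ) := by exact_mod_cast (by omega : 1 ≤ 2 * (2 * k))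
  have hmul := eLpNorm_mul_add_le (ρ := π) (r := (2 * k : ℕ)) hq (u := fun z => ‖z.1 - z.2‖)
    (v := fun z => ‖z.2‖) (Continuous.aestronglyMeasurable (by fun_prop))
    (Continuous.aestronglyMeasurable (by fun_prop)) (b := 2 * √(n : ℝ)) (by positivity) hβ hδ
    (by rwa [eLpNorm_norm]) (by rwa [eLpNorm_norm])
  rw [ENNReal.ofReal_mul (by positivity)]
  refine (eLpNorm_le_mul_eLpNorm_of_ae_le_mul (ae_of_all _ fun z => ?_) _).trans
    (mul_le_mul_right hmul _)
  refine (hh.norm_empiricalKernel_sub_le z.1 z.2).trans ?_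
  exact mul_le_mul_of_nonneg_left (le_abs_self _) (by positivity)

theorem exists_eLpNorm_stackRows_le {μ : Measure (EuclideanSpace ℝ S)} [IsProbabilityMeasure μ]
    {k : ℕ} (hk : k ≠ 0) (hμ : MemLp (fun z => z) (2 * k : ℕ) μ) :
    ∃ c : ℝ, 0 ≤ c ∧ ∀ n : ℕ,
      eLpNorm (fun A => A) (2 * k : ℕ) ((Measure.pi fun _ : Fin n => μ).map stackRows) ≤
        ENNReal.ofReal (c * √(n : ℝ)) := by
  have hs : ∀ s, MemLp (fun z : EuclideanSpace ℝ S => z s) (2 * k : ℕ) μ := fun s =>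
    hμ.mono (Continuous.aestronglyMeasurable (by fun_prop))
      (ae_of_all _ fun z => PiLp.norm_apply_le z s)
  set b : S → ℝ := fun s => (eLpNorm (fun z : EuclideanSpace ℝ S => z s) (2 * k : ℕ) μ).toReal
  refine ⟨√(∑ s, b s ^ 2), by positivity, fun n => ?_⟩
  refine (eLpNorm_euclidean_le hk (Continuous.aestronglyMeasurable (by fun_prop))
    (r := fun u => b u.2) (fun u => ENNReal.toReal_nonneg) fun u => ?_).trans
    (ENNReal.ofReal_le_ofReal (le_of_eq ?_))
  · rw [eLpNorm_map_measure (Continuous.aestronglyMeasurable (by fun_prop))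
      measurable_stackRows.aemeasurable]
    have hmp := measurePreserving_eval (fun _ : Fin n => μ) u.1
    have := eLpNorm_comp_measurePreserving (p := (2 * k : ℕ)) (hs u.2).1 hmp
    refine le_of_eq (Eq.trans ?_ (this.trans (ENNReal.ofReal_toReal (hs u.2).2.ne).symm))
    rfl
  · rw [Fintype.sum_prod_type]
    simp only [Finset.sum_const, Finset.card_univ, Fintype.card_fin, nsmul_eq_mul]
    rw [mul_comm, Real.sqrt_mul (by positivity)]

end TensorSquares

/-! ### Induction over the layers and the kernel estimate -/

section MainEstimates

variable {S : ℕ → Type*} {a : ℕ → ℕ}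
  {σ : ∀ ℓ, EuclideanSpace ℝ (S ℓ) → EuclideanSpace ℝ (Fin (a (ℓ + 1)) × S (ℓ + 1))}
  {x : EuclideanSpace ℝ (S 0)} [∀ ℓ, Fintype (S ℓ)] [∀ ℓ, DecidableEq (S ℓ)] {L : ℕ}

/-- Fluctuations of empirical averages over independent copies of the limit, which vanish for the
deterministic input. -/
theorem exists_eLpNorm_average_limitLaw_le.{u, v} {S : ℕ → Type u}
    {σ : ∀ ℓ, EuclideanSpace ℝ (S ℓ) → EuclideanSpace ℝ (Fin (a (ℓ + 1)) × S (ℓ + 1))}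
    {x : EuclideanSpace ℝ (S 0)} [∀ ℓ, Fintype (S ℓ)] [∀ ℓ, DecidableEq (S ℓ)] (ℓ : ℕ)
    {k : ℕ} (hk : k ≠ 0) :
    ∃ C : ℝ, 0 ≤ C ∧ ∀ (H : Type v) [NormedAddCommGroup H] [InnerProductSpace ℝ H]
      [CompleteSpace H] (φ : EuclideanSpace ℝ (S ℓ) → H) (D : ℝ),
      AEStronglyMeasurable φ (limitLaw σ x ℓ) → 0 ≤ D →
      (∀ z, ‖φ z‖ ≤ D * (1 + ‖z‖) ^ 2) → ∀ n : ℕ, 0 < n →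
      eLpNorm (fun g : Fin n → EuclideanSpace ℝ (S ℓ) =>
          (n : ℝ)⁻¹ • ∑ i, φ (g i) - ∫ z, φ z ∂(limitLaw σ x ℓ)) (2 * k : ℕ)
        (Measure.pi fun _ : Fin n => limitLaw σ x ℓ) ≤
          ENNReal.ofReal (C * D * if ℓ = 0 then 0 else 1 / √(n : ℝ)) := by
  cases ℓ with
  | zero =>
    refine ⟨0, le_rfl, fun H _ _ _ φ D _ _ _ n hn => ?_⟩
    simp only [limitLaw, Measure.pi_dirac_const]
    rw [eLpNorm_congr_ae (ae_eq_dirac _), integral_dirac]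
    have hn0 : (n : ℝ) ≠ 0 := by exact_mod_cast hn.ne'
    have : (n : ℝ)⁻¹ • ∑ _i : Fin n, φ x - φ x = 0 := by
      rw [Finset.sum_const, Finset.card_univ, Fintype.card_fin, ← Nat.cast_smul_eq_nsmul ℝ,
        smul_smul, inv_mul_cancel₀ hn0, one_smul, sub_self]
    rw [this]
    simp
  | succ ℓ =>
    obtain ⟨C, hC, h⟩ := exists_eLpNorm_average_sub_le.{u, v} (limitLaw σ x (ℓ + 1))
      (fun q => memLp_limitLaw (ℓ + 1) q) hk
    refine ⟨C, hC, fun H _ _ _ φ D hφ hD hb n hn => (h H φ D hφ hD hb n hn).trans ?_⟩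
    rw [if_neg (by omega), mul_one_div]

theorem sum_Ico_one_succ (f : ℕ → ℝ) (ℓ : ℕ) :
    ∑ i ∈ Finset.Ico 1 (ℓ + 1), f i =
      ∑ i ∈ Finset.Ico 1 ℓ, f i + if ℓ = 0 then 0 else f ℓ := by
  rcases Nat.eq_zero_or_pos ℓ with rfl | h
  · simp
  · rw [Finset.sum_Ico_succ_top h, if_neg h.ne']

theorem exists_wasserstein_networkLaw_le
    (hσ : ∀ ℓ < L, ∃ κ : ℝ≥0, LipschitzWith κ (σ ℓ)) {k : ℕ} (hk : k ≠ 0) {ℓ : ℕ} (hℓ : ℓ ≤ L) :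
    ∃ c : ℝ, 0 ≤ c ∧ ∀ n : ℕ → ℕ, n 0 = 1 → (∀ ℓ, 1 ≤ ℓ → ℓ ≤ L → 0 < n ℓ) →
      wasserstein (2 * k : ℕ) (networkLaw σ x n ℓ) (limitLawCopies σ x (n ℓ) ℓ) ≤
        ENNReal.ofReal (c * √(n ℓ : ℝ) * ∑ i ∈ Finset.Ico 1 ℓ, 1 / √(n i : ℝ)) := by
  induction ℓ with
  | zero =>
    refine ⟨0, le_rfl, fun n _ _ => ?_⟩
    rw [limitLawCopies_zero, networkLaw, wasserstein_self]
    exact zero_le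
  | succ ℓ ih =>
    obtain ⟨c, hc, ih⟩ := ih (by omega)
    obtain ⟨κ, hκ⟩ := hσ ℓ hℓ
    obtain ⟨c₁, hc₁, h₁⟩ := hκ.exists_wasserstein_layerLaw_le hk
    obtain ⟨c₂, φ, hc₂, hφ, ⟨D, hD, hφD⟩, h₂⟩ := hκ.exists_wasserstein_layerLaw_copies_le
      (μ := limitLaw σ x ℓ) (by simpa using memLp_limitLaw (σ := σ) (x := x) ℓ 2) hk
    obtain ⟨C, hC, h₃⟩ := exists_eLpNorm_average_limitLaw_le (σ := σ) (x := x) ℓ hk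
    refine ⟨c₁ * c + c₂ * (C * D), by positivity, fun n hn0 hn => ?_⟩
    have hnℓ : 0 < n ℓ := by
      rcases Nat.eq_zero_or_pos ℓ with rfl | h
      · omega
      · exact hn ℓ h (by omega)
    have hn' : 0 < √(n ℓ : ℝ) := Real.sqrt_pos.2 (by exact_mod_cast hnℓ)
    set s := ∑ i ∈ Finset.Ico 1 ℓ, 1 / √(n i : ℝ) with hs
    -- The fluctuation created at layer `ℓ`, which is the new term of the sum; the input creates
    -- none.
    set e : ℝ := if ℓ = 0 then 0 else 1 / √(n ℓ : ℝ) with he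
    have hs0 : 0 ≤ s := Finset.sum_nonneg fun i _ => by positivity
    have he0 : 0 ≤ e := by rw [he]; split_ifs <;> positivity
    have hcont : ∀ m < ℓ, Continuous (σ m) := fun m hm =>
      (hσ m (by omega)).choose_spec.continuous
    have := isProbabilityMeasure_networkLaw σ x n ℓ hcont
    have := isProbabilityMeasure_networkLaw σ x n (ℓ + 1) fun m hm =>
      (hσ m (by omega)).choose_spec.continuous
    have := isProbabilityMeasure_layerLaw (n' := n (ℓ + 1)) hκ.continuous
      (limitLawCopies σ x (n ℓ) ℓ)
    have hp : (1 : ℝ) ≤ (2 * k : ℕ) := by exact_mod_cast (by omega : 1 ≤ 2 * k)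
    refine (wasserstein_triangle hp (networkLaw σ x n (ℓ + 1))
      (layerLaw (σ ℓ) (n (ℓ + 1)) (limitLawCopies σ x (n ℓ) ℓ)) _).trans ?_
    have b₁ := h₁ (n ℓ) (n (ℓ + 1)) (networkLaw σ x n ℓ) (limitLawCopies σ x (n ℓ) ℓ) _
      (by positivity) (ih n hn0 hn)
    have b₂ := (h₂ (n ℓ) (n (ℓ + 1)) hnℓ).trans (mul_le_mul_right
      (h₃ _ φ D hφ.aestronglyMeasurable hD hφD (n ℓ) hnℓ) _)
    rw [← ENNReal.ofReal_mul (by positivity)] at b₂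
    refine (add_le_add b₁ b₂).trans ?_
    rw [← ENNReal.ofReal_add (by positivity) (by positivity), sum_Ico_one_succ]
    refine ENNReal.ofReal_le_ofReal ?_
    rw [← hs, ← he]
    -- Here `√(n ℓ)` cancels: earlier errors are transported with a constant free of the widths.
    have e1 : c₁ * (√(n (ℓ + 1) : ℝ) / √(n ℓ : ℝ)) * (c * √(n ℓ : ℝ) * s) =
        c₁ * c * √(n (ℓ + 1) : ℝ) * s := by
      field_simp
    rw [e1]
    have q1 : 0 ≤ c₁ * c * √(n (ℓ + 1) : ℝ) * e := by positivity
    have q2 : 0 ≤ c₂ * (C * D) * √(n (ℓ + 1) : ℝ) * s := by positivity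
    linarith

theorem exists_wasserstein_empiricalKernel_le.{u, v} {S : ℕ → Type u}
    {σ : ∀ ℓ, EuclideanSpace ℝ (S ℓ) → EuclideanSpace ℝ (Fin (a (ℓ + 1)) × S (ℓ + 1))}
    {x : EuclideanSpace ℝ (S 0)} [∀ ℓ, Fintype (S ℓ)] [∀ ℓ, DecidableEq (S ℓ)]
    (hσ : ∀ ℓ < L, ∃ κ : ℝ≥0, LipschitzWith κ (σ ℓ)) {k : ℕ} (hk : k ≠ 0) {ℓ : ℕ} (hℓ : ℓ ≤ L) :
    ∃ c : ℝ, 0 ≤ c ∧ ∀ n : ℕ → ℕ, n 0 = 1 → (∀ ℓ, 1 ≤ ℓ → ℓ ≤ L → 0 < n ℓ) →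
      ∀ (T : Type v) [Fintype T] (h : EuclideanSpace ℝ (S ℓ) → EuclideanSpace ℝ T) (κ : ℝ≥0),
      LipschitzWith κ h →
      wasserstein (2 * k : ℕ) ((networkLaw σ x n ℓ).map (empiricalKernel h))
          (Measure.dirac (∫ z, tensorSq (h z) ∂(limitLaw σ x ℓ))) ≤
        ENNReal.ofReal (c * (‖h 0‖ + κ) ^ 2 * ∑ i ∈ Finset.Icc 1 ℓ, 1 / √(n i : ℝ)) := by
  rcases Nat.eq_zero_or_pos ℓ with rfl | hpos
  · refine ⟨0, le_rfl, fun n hn0 _ T _ h κ hh => ?_⟩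
    have hn : (n 0 : ℝ) ≠ 0 := by simp [hn0]
    have e : empiricalKernel (n := n 0) h (WithLp.toLp 2 fun q => x q.2) = tensorSq (h x) := by
      have : ∀ i : Fin (n 0),
          row (WithLp.toLp 2 fun q => x q.2 : EuclideanSpace ℝ (Fin (n 0) × S 0)) i = x :=
        fun i => rfl
      simp only [empiricalKernel, this]
      rw [Finset.sum_const, Finset.card_univ, Fintype.card_fin, ← Nat.cast_smul_eq_nsmul ℝ,
        smul_smul, inv_mul_cancel₀ hn, one_smul]
    rw [networkLaw, Measure.map_dirac' (continuous_empiricalKernel hh.continuous).measurable, e,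
      limitLaw, integral_dirac, wasserstein_self]
    exact zero_le
  -- The array distance is used at order `4k`, because Hölder's inequality bounds a product in
  -- `L^(2k)` by two `L^(4k)` norms.
  have hk2 : 2 * k ≠ 0 := by omega
  obtain ⟨c₁, hc₁, h₁⟩ := exists_wasserstein_networkLaw_le (x := x) hσ hk2 hℓ
  obtain ⟨c₃, hc₃, h₃⟩ := exists_eLpNorm_stackRows_le hk2
    (memLp_limitLaw (σ := σ) (x := x) ℓ (2 * (2 * k)))
  obtain ⟨C, hC, h₂⟩ := exists_eLpNorm_average_limitLaw_le.{u, v} (σ := σ) (x := x) ℓ hk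
  refine ⟨(c₁ + 1) * (2 + 2 * c₃ + (c₁ + 1) * ℓ) + C, by positivity,
    fun n hn0 hn T _ h κ hh => ?_⟩
  have hnℓ : 0 < n ℓ := hn ℓ hpos hℓ
  have hnR : (0 : ℝ) < n ℓ := by exact_mod_cast hnℓ
  have hn' : 0 < √(n ℓ : ℝ) := Real.sqrt_pos.2 hnR
  set H := ‖h 0‖ + κ with hH
  have hH0 : 0 ≤ H := by positivity
  set s := ∑ i ∈ Finset.Icc 1 ℓ, 1 / √(n i : ℝ) with hs
  set s' := ∑ i ∈ Finset.Ico 1 ℓ, 1 / √(n i : ℝ) with hs'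
  have hss' : s = s' + 1 / √(n ℓ : ℝ) := by
    rw [hs, hs', ← Finset.sum_Ico_succ_top hpos]
    rfl
  have hs'0 : 0 ≤ s' := Finset.sum_nonneg fun i _ => by positivity
  have hs0 : 0 < s := by rw [hss']; positivity
  -- Widths are at least `1`, so `s` is bounded; this makes the term quadratic in `δ` linear in `s`.
  have hsℓ : s ≤ ℓ := by
    have : s ≤ ∑ i ∈ Finset.Icc 1 ℓ, (1 : ℝ) := Finset.sum_le_sum fun i hi => by
      rw [Finset.mem_Icc] at hi
      have := hn i hi.1 (hi.2.trans hℓ)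
      have h1 : (1 : ℝ) ≤ √(n i : ℝ) := Real.one_le_sqrt.2 (by exact_mod_cast this)
      exact (div_le_one (by linarith)).2 h1
    simpa using this
  -- Using `c₁ + 1` makes `δ` positive and strictly larger than the Wasserstein bound, even when
  -- that bound is `0`, so a coupling below `δ` exists.
  set δ := (c₁ + 1) * √(n ℓ : ℝ) * s with hδ
  have hδ0 : 0 < δ := by positivity
  have hlt : wasserstein (2 * (2 * k) : ℕ) (networkLaw σ x n ℓ) (limitLawCopies σ x (n ℓ) ℓ) <
      ENNReal.ofReal δ := by
    refine (h₁ n hn0 hn).trans_lt ((ENNReal.ofReal_lt_ofReal_iff hδ0).2 ?_)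
    have q1 : c₁ * √(n ℓ : ℝ) * s' ≤ c₁ * √(n ℓ : ℝ) * s := by
      gcongr
      rw [hss']
      exact le_add_of_nonneg_right (by positivity)
    have q2 : 0 < √(n ℓ : ℝ) * s := by positivity
    rw [hδ]
    linarith
  have hcont : ∀ m < ℓ, Continuous (σ m) := fun m hm =>
    (hσ m (by omega)).choose_spec.continuous
  have := isProbabilityMeasure_networkLaw σ x n ℓ hcont
  obtain ⟨π, _, hπ₁, hπ₂, hπ⟩ := exists_coupling_lt hlt
  rw [ENNReal.ofReal_natCast] at hπ
  set m := ∫ z, tensorSq (h z) ∂(limitLaw σ x ℓ) with hm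
  have hemp := continuous_empiricalKernel (n := n ℓ) hh.continuous
  have e₁ : π.map (fun z => empiricalKernel h z.1) =
      (networkLaw σ x n ℓ).map (empiricalKernel h) := by
    rw [← hπ₁, Measure.fst, Measure.map_map hemp.measurable measurable_fst]
    rfl
  have e₂ : π.map (fun _ => m) = Measure.dirac m := by simp [Measure.map_const]
  rw [← e₁, ← e₂]
  refine (wasserstein_map_le _ π (X := fun z => empiricalKernel h z.1) (Y := fun _ => m)
    (hemp.measurable.comp measurable_fst).aemeasurable aemeasurable_const).trans ?_
  rw [ENNReal.ofReal_natCast]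
  have hsplit : (fun z : EuclideanSpace ℝ (Fin (n ℓ) × S ℓ) × EuclideanSpace ℝ (Fin (n ℓ) × S ℓ) =>
      empiricalKernel h z.1 - m) = (fun z => empiricalKernel h z.1 - empiricalKernel h z.2) +
        fun z => empiricalKernel h z.2 - m := by
    funext z
    simp
  have hp1 : (1 : ℝ≥0∞) ≤ (2 * k : ℕ) := by exact_mod_cast (by omega : 1 ≤ 2 * k)
  rw [hsplit]
  refine (eLpNorm_add_le (Continuous.aestronglyMeasurable (by fun_prop))
    (Continuous.aestronglyMeasurable (by fun_prop)) hp1).trans ?_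
  have hfluct : eLpNorm (fun z : EuclideanSpace ℝ (Fin (n ℓ) × S ℓ) ×
      EuclideanSpace ℝ (Fin (n ℓ) × S ℓ) => empiricalKernel h z.2 - m) (2 * k : ℕ) π ≤
      ENNReal.ofReal (C * H ^ 2 * s) := by
    have hb : ∀ z, ‖tensorSq (h z)‖ ≤ H ^ 2 * (1 + ‖z‖) ^ 2 := fun z => by
      rw [norm_tensorSq, ← mul_pow]
      exact pow_le_pow_left₀ (norm_nonneg _) (hh.exists_norm_le z) 2
    have h4 := h₂ _ (fun z => tensorSq (h z)) (H ^ 2)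
      (continuous_tensorSq.comp hh.continuous).aestronglyMeasurable (by positivity) hb (n ℓ) hnℓ
    have e : eLpNorm (fun z : EuclideanSpace ℝ (Fin (n ℓ) × S ℓ) ×
        EuclideanSpace ℝ (Fin (n ℓ) × S ℓ) => empiricalKernel h z.2 - m) (2 * k : ℕ) π =
        eLpNorm (fun A => empiricalKernel h A - m) (2 * k : ℕ) π.snd := by
      rw [Measure.snd, eLpNorm_map_measure (Continuous.aestronglyMeasurable (by fun_prop))
        measurable_snd.aemeasurable]
      rfl
    rw [e, hπ₂, limitLawCopies_eq, eLpNorm_map_measure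
      (Continuous.aestronglyMeasurable (by fun_prop)) measurable_stackRows.aemeasurable]
    refine h4.trans (ENNReal.ofReal_le_ofReal ?_)
    rw [if_neg hpos.ne']
    gcongr
    rw [hss']
    exact le_add_of_nonneg_left hs'0
  have hB : eLpNorm (fun z : EuclideanSpace ℝ (Fin (n ℓ) × S ℓ) ×
      EuclideanSpace ℝ (Fin (n ℓ) × S ℓ) => z.2) (2 * (2 * k) : ℕ) π ≤
      ENNReal.ofReal (c₃ * √(n ℓ : ℝ)) := by
    have h4 := h₃ (n ℓ)
    rw [← limitLawCopies_eq, ← hπ₂, Measure.snd,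
      eLpNorm_map_measure (Continuous.aestronglyMeasurable (by fun_prop))
        measurable_snd.aemeasurable] at h4
    exact h4
  have hcoup := hh.eLpNorm_empiricalKernel_sub_le hk (by positivity) hδ0.le hπ.le hB
  refine (add_le_add hcoup hfluct).trans ?_
  rw [← ENNReal.ofReal_add (by positivity) (by positivity)]
  refine ENNReal.ofReal_le_ofReal ?_
  have hδle : δ ≤ (c₁ + 1) * √(n ℓ : ℝ) * ℓ := by
    rw [hδ]
    gcongr
  have hfin : H ^ 2 * (n ℓ : ℝ)⁻¹ * (δ * (2 * √(n ℓ : ℝ) + 2 * (c₃ * √(n ℓ : ℝ)) + δ)) ≤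
      H ^ 2 * ((c₁ + 1) * (2 + 2 * c₃ + (c₁ + 1) * ℓ)) * s := by
    calc _ ≤ H ^ 2 * (n ℓ : ℝ)⁻¹ * (δ * (2 * √(n ℓ : ℝ) + 2 * (c₃ * √(n ℓ : ℝ)) +
          (c₁ + 1) * √(n ℓ : ℝ) * ℓ)) := by gcongr
      _ = H ^ 2 * ((c₁ + 1) * (2 + 2 * c₃ + (c₁ + 1) * ℓ)) * s *
          ((n ℓ : ℝ)⁻¹ * (√(n ℓ : ℝ) * √(n ℓ : ℝ))) := by rw [hδ]; ring
      _ = _ := by rw [Real.mul_self_sqrt hnR.le, inv_mul_cancel₀ hnR.ne', mul_one]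
  linarith

end MainEstimates

theorem mainTheorem2 {S : ℕ → Type*} [∀ ℓ, Fintype (S ℓ)] [∀ ℓ, DecidableEq (S ℓ)] {a : ℕ → ℕ}
    (L : ℕ)
    (σ : ∀ ℓ, EuclideanSpace ℝ (S ℓ) → EuclideanSpace ℝ (Fin (a (ℓ + 1)) × S (ℓ + 1)))
    (hσ : ∀ ℓ < L, ∃ κ : ℝ≥0, LipschitzWith κ (σ ℓ))
    (x : EuclideanSpace ℝ (S 0)) (p : ℝ) (hp : 1 ≤ p) :
    ∃ c : ℝ, 0 < c ∧
      ∀ (n : ℕ → ℕ), n 0 = 1 → (∀ ℓ, 1 ≤ ℓ → ℓ ≤ L → 0 < n ℓ) →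
      ∀ (Ω : Type*) [MeasurableSpace Ω] (P : Measure Ω) [IsProbabilityMeasure P]
        (W : ∀ ℓ, Fin (n (ℓ + 1)) → Fin (n ℓ) → Fin (a (ℓ + 1)) → Ω → ℝ),
        IsGaussianWeights P L n a W →
      ∀ ℓ ≤ L,
        wasserstein p
            (P.map fun ω => network σ x n (fun m i j α => W m i j α ω) ℓ)
            (limitLawCopies σ x (n ℓ) ℓ)
          ≤ ENNReal.ofReal (c * √(n ℓ : ℝ) * ∑ i ∈ Finset.Ico 1 ℓ, 1 / √(n i : ℝ)) ∧
        ∀ (T : Type*) [Fintype T] (h : EuclideanSpace ℝ (S ℓ) → EuclideanSpace ℝ T) (κ : ℝ≥0),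
          LipschitzWith κ h →
          wasserstein p
              (P.map fun ω => empiricalKernel h (network σ x n (fun m i j α => W m i j α ω) ℓ))
              (Measure.dirac (∫ z, tensorSq (h z) ∂(limitLaw σ x ℓ)))
            ≤ ENNReal.ofReal
                (c * (‖h 0‖ + κ) ^ 2 * ∑ i ∈ Finset.Icc 1 ℓ, 1 / √(n i : ℝ)) := by
  -- The order `p` is raised to an even integer `2k ≥ p`.
  obtain ⟨k, hk⟩ := exists_nat_ge p
  have hk0 : k ≠ 0 := by
    rintro rfl
    norm_num at hk
    linarith
  have hpk : p ≤ (2 * k : ℕ) := by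
    push_cast
    linarith [(k.cast_nonneg : (0 : ℝ) ≤ k)]
  choose! c₁ hc₁ h₁ using fun (ℓ : ℕ) (hℓ : ℓ ≤ L) =>
    exists_wasserstein_networkLaw_le (x := x) hσ hk0 hℓ
  choose! c₂ hc₂ h₂ using fun (ℓ : ℕ) (hℓ : ℓ ≤ L) =>
    exists_wasserstein_empiricalKernel_le (x := x) hσ hk0 hℓ
  -- The sum dominates the constants of all layers, and the `1` keeps `c` positive.
  set c := 1 + ∑ ℓ ∈ Finset.range (L + 1), (c₁ ℓ + c₂ ℓ) with hc
  have hle : ∀ ℓ ≤ L, c₁ ℓ + c₂ ℓ ≤ c := fun ℓ hℓ =>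
    (Finset.single_le_sum (f := fun ℓ => c₁ ℓ + c₂ ℓ) (fun m hm => by
      have := Finset.mem_range.1 hm
      exact add_nonneg (hc₁ m (by omega)) (hc₂ m (by omega)))
      (Finset.mem_range.2 (by omega : ℓ < L + 1))).trans (le_add_of_nonneg_left zero_le_one)
  have hcpos : 0 < c := by
    have : 0 ≤ ∑ ℓ ∈ Finset.range (L + 1), (c₁ ℓ + c₂ ℓ) := Finset.sum_nonneg fun m hm => by
      have := Finset.mem_range.1 hm
      exact add_nonneg (hc₁ m (by omega)) (hc₂ m (by omega))
    linarith
  refine ⟨c, hcpos, fun n hn0 hn Ω _ P _ W hW ℓ hℓ => ?_⟩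
  have hcont : ∀ m < L, Continuous (σ m) := fun m hm => (hσ m hm).choose_spec.continuous
  have hcont' : ∀ m < ℓ, Continuous (σ m) := fun m hm => hcont m (by omega)
  have := isProbabilityMeasure_networkLaw σ x n ℓ hcont'
  have hmap := hW.map_network (x := x) hcont hℓ
  have hc₁c : c₁ ℓ ≤ c := by linarith [hle ℓ hℓ, hc₂ ℓ hℓ]
  have hc₂c : c₂ ℓ ≤ c := by linarith [hle ℓ hℓ, hc₁ ℓ hℓ]
  refine ⟨?_, fun T _ h κ hh => ?_⟩
  · rw [hmap]
    refine (wasserstein_mono_exponent hpk _ _).trans ((h₁ ℓ hℓ n hn0 hn).trans ?_)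
    gcongr
  · have hemp := continuous_empiricalKernel (n := n ℓ) hh.continuous
    have hmeas : AEMeasurable (fun ω => network σ x n (fun m i j α => W m i j α ω) ℓ) P := by
      -- A map that is not almost everywhere measurable has pushforward `0` by convention, whereas
      -- this one is a probability measure.
      refine AEMeasurable.of_map_ne_zero ?_
      rw [hmap]
      exact NeZero.ne _
    have e : P.map (fun ω => empiricalKernel h (network σ x n (fun m i j α => W m i j α ω) ℓ)) =
        (networkLaw σ x n ℓ).map (empiricalKernel h) := by
      rw [← hmap, AEMeasurable.map_map_of_aemeasurable hemp.aemeasurable hmeas]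
      rfl
    have := Measure.isProbabilityMeasure_map (μ := networkLaw σ x n ℓ) hemp.aemeasurable
    rw [e]
    refine (wasserstein_mono_exponent hpk _ _).trans ((h₂ ℓ hℓ n hn0 hn T h κ hh).trans ?_)
    gcongr
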